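/- Let $(\mathbb{R}/\mathbb{Z})^n$ be the $n$-dimensional torus and $\pi:\mathbb{R}^n\to(\mathbb{R}/\mathbb{Z})^n$ the quotient map. For a closed set $X\subseteq(\mathbb{R}/\mathbb{Z})^n$ let $D(X)$ be the $L^\infty$-distance from $X$ to the point $(1/2,\dots,1/2)$, and call $X$ proper if it is not contained in the union of the coordinate hyperplanes $\{x_i=0\}$, $1\le i\le n$. A $1$-dimensional subtorus is a subgroup of the form $\pi(\mathbb{R}v)$ with $v\in\mathbb{Z}^n\setminus\{0\}$. A $1$-dimensional closed subgroup is a closed subgroup that is the direct product of a $1$-dimensional subtorus and a finite subgroup. For $n\ge 1$ let $\mathcal{S}(n)$ be the set of all values $D(T)$ as $T$ ranges over the $1$-dimensional proper subtori of $(\mathbb{R}/\mathbb{Z})^n$, and let $\mathcal{S}^*(n)$ be the set of all values $D(\Delta)$ as $\Delta$ ranges over the $1$-dimensional proper closed subgroups of $(\mathbb{R}/\mathbb{Z})^n$. For every $n\ge 1$ the sets $\mathcal{S}(n)$ and $\mathcal{S}^*(n)$ are closed subsets of $\mathbb{R}$, and each of them is well-ordered by the decreasing order $>$ (that is, every nonempty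 subset has a largest element). For every $n\ge 2$, each of $\mathcal{S}(n)$ and $\mathcal{S}^*(n)$, ordered decreasingly, has order type $\omega^{n-1}+1$. -/

import Mathlib

namespace LonelyRunner

/-- The torus `(ℝ/ℤ)^n`. Its distance is the sup over the coordinates of the distance in `ℝ/ℤ`,
that is, the `L^∞`-distance. -/
abbrev Torus (n : ℕ) : Type := Fin n → UnitAddCircle

/-- The quotient map `π : ℝ^n → (ℝ/ℤ)^n`. -/
noncomputable def proj (n : ℕ) : (Fin n → ℝ) →+ Torus n :=
  (QuotientAddGroup.mk' (AddSubgroup.zmultiples (1 : ℝ))).compLeft (Fin n)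

/-- The point `(1/2, …, 1/2)` of the torus. -/
noncomputable def center (n : ℕ) : Torus n := proj n (fun _ => 1 / 2)

/-- `D(X)`: the `L^∞`-distance from `X` to `(1/2, …, 1/2)`. -/
noncomputable def D {n : ℕ} (X : Set (Torus n)) : ℝ := Metric.infDist (center n) X

/-- `X` is proper if it is not contained in the union of the coordinate hyperplanes `x_i = 0`. -/
def IsProper {n : ℕ} (X : Set (Torus n)) : Prop :=
  ¬ X ⊆ ⋃ i : Fin n, {x : Torus n | x i = 0}

/-- `T` is a `k`-dimensional subtorus of `(ℝ/ℤ)^n`: it is the image under `π` of a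
`k`-dimensional rational subspace of `ℝ^n`, i.e. `T = π(⟨u_1, …, u_k⟩_ℝ)` for some
linearly independent integer vectors `u_1, …, u_k`. -/
def IsSubtorus {n : ℕ} (k : ℕ) (T : AddSubgroup (Torus n)) : Prop :=
  ∃ u : Fin k → Fin n → ℤ,
    LinearIndependent ℝ (fun (j : Fin k) (i : Fin n) => (u j i : ℝ)) ∧
    T = (Submodule.span ℝ
      (Set.range fun (j : Fin k) (i : Fin n) => (u j i : ℝ))).toAddSubgroup.map (proj n)

/-- `Δ` is a `k`-dimensional closed subgroup of `(ℝ/ℤ)^n`: it is closed, and it is the (internal)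
direct product of a `k`-dimensional subtorus and a finite subgroup. -/
def IsClosedSubgroupOfDim {n : ℕ} (k : ℕ) (Δ : AddSubgroup (Torus n)) : Prop :=
  IsClosed (Δ : Set (Torus n)) ∧
    ∃ T H : AddSubgroup (Torus n),
      IsSubtorus k T ∧ (H : Set (Torus n)).Finite ∧ T ⊓ H = ⊥ ∧ T ⊔ H = Δ

/-- `S_k(n)`: the values `D(T)` over the `k`-dimensional proper subtori `T` of `(ℝ/ℤ)^n`. -/
def torusSpectrum (k n : ℕ) : Set ℝ :=
  {d | ∃ T : AddSubgroup (Torus n),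
    IsSubtorus k T ∧ IsProper (T : Set (Torus n)) ∧ D (T : Set (Torus n)) = d}

/-- `S*_k(n)`: the values `D(Δ)` over the `k`-dimensional proper closed subgroups `Δ` of
`(ℝ/ℤ)^n`. -/
def subgroupSpectrum (k n : ℕ) : Set ℝ :=
  {d | ∃ Δ : AddSubgroup (Torus n),
    IsClosedSubgroupOfDim k Δ ∧ IsProper (Δ : Set (Torus n)) ∧ D (Δ : Set (Torus n)) = d}

/-- The Lonely Runner spectrum `S(n) = S_1(n)`. -/
def S (n : ℕ) : Set ℝ := torusSpectrum 1 n

/-- The subgroup Lonely Runner spectrum `S*(n) = S*_1(n)`. -/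
def SStar (n : ℕ) : Set ℝ := subgroupSpectrum 1 n

/-- The relation "`a` comes before `b`" on a set of reals listed in decreasing order. -/
def Before (A : Set ℝ) : A → A → Prop := fun a b => (b : ℝ) < (a : ℝ)

/-- `A`, listed in decreasing order, is well-ordered with order type `o`. -/
def HasDecreasingOrderType (A : Set ℝ) (o : Ordinal.{0}) : Prop :=
  ∃ _ : IsWellOrder A (Before A), Ordinal.type (Before A) = o

end LonelyRunner

open Filter Topology

namespace LonelyRunner

variable {n : ℕ}

/-! The proof rests on compactness of the space of closed subgroups. Near a closed subgroup Γ its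
preimage in ℝ^n is linear (`exists_lineal_nhds`), so distance to Γ doubles under y ↦ 2y, and a
subgroup close enough to Γ lies in Γ. Hence along an ultrafilter almost all subgroups are contained
in their limit (`eventually_le_limitSubgroup`), and `D` converges to its value at the limit. Since
`D` is antitone, its values cannot increase strictly forever, which gives the well-order.

For closedness, an extreme optimal point of a closed subgroup is torsion
(`exists_torsion_of_extreme`). Together with a rational line it generates a one-dimensional closed
subgroup with the same value. For subtori the line can be chosen through the optimal point itself.

The order type comes from accumulation points. A limit of values different from it arises from a
limit group of dimension at least two. There an extreme optimal point has two coordinates of equal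
extremal modulus, and identifying them up to sign removes one ambient dimension
(`mem_SStar_of_tendsto`). So limit points of `SStar (n + 1)` lie in `SStar n`, down to `SStar 1 ⊆
{0}`, which bounds the type above. Conversely, appending a large, highly divisible speed makes each
point of `S n` a limit of larger points of `S (n + 1)` (`exists_mem_S_succ_between`), which bounds
the type of `S n` below. The inclusion of `S n` in `SStar n` closes the circle. -/

theorem proj_apply (v : Fin n → ℝ) (i : Fin n) : proj n v i = (v i : UnitAddCircle) := rfl

theorem continuous_proj : Continuous (proj n) :=
  continuous_pi fun i => (AddCircle.continuous_mk' 1).comp (continuous_apply i)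

theorem norm_proj_le (v : Fin n → ℝ) : ‖proj n v‖ ≤ ‖v‖ := by
  refine (pi_norm_le_iff_of_nonneg (norm_nonneg v)).2 fun i => ?_
  refine le_trans ?_ (norm_le_pi_norm v i)
  rw [proj_apply]
  exact QuotientAddGroup.norm_mk_le_norm

theorem exists_lift_norm (y : Torus n) : ∃ w : Fin n → ℝ, proj n w = y ∧ ‖w‖ = ‖y‖ := by
  have h : ∀ i, ∃ r : ℝ, (r : UnitAddCircle) = y i ∧ |r| = ‖y i‖ := by
    intro i
    obtain ⟨r, hr⟩ := QuotientAddGroup.mk_surjective (y i)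
    refine ⟨r - round r, ?_, ?_⟩
    · rw [← hr]
      have : ((round r : ℝ) : UnitAddCircle) = 0 :=
        (AddCircle.coe_eq_zero_iff 1).2 ⟨round r, by simp⟩
      have h2 : ((r - round r : ℝ) : UnitAddCircle) = (r : UnitAddCircle) - ((round r : ℝ) : UnitAddCircle) := rfl
      rw [h2, this, sub_zero]
    · rw [← hr]; exact (UnitAddCircle.norm_eq (x := r)).symm
  choose w hw hw' using h
  refine ⟨w, funext hw, ?_⟩
  simp only [Pi.norm_def]
  congr 1
  refine Finset.sup_congr rfl fun i _ => ?_
  ext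
  simpa using hw' i

theorem proj_eq_zero_iff (v : Fin n → ℝ) :
    proj n v = 0 ↔ ∃ m : Fin n → ℤ, v = fun i => (m i : ℝ) := by
  constructor
  · intro h
    have : ∀ i, ∃ m : ℤ, v i = m := fun i => by
      obtain ⟨m, hm⟩ := (AddCircle.coe_eq_zero_iff (1 : ℝ)).1 (congrFun h i)
      exact ⟨m, by simpa using hm.symm⟩
    choose m hm using this
    exact ⟨m, funext hm⟩
  · rintro ⟨m, rfl⟩
    funext i
    exact (AddCircle.coe_eq_zero_iff (1 : ℝ)).2 ⟨m i, by simp⟩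

/-! ### Linear parts of closed subgroups -/

/-- The largest linear subspace contained in the preimage of `Γ` in `ℝ^n`. -/
def lineal (Γ : AddSubgroup (Torus n)) : Submodule ℝ (Fin n → ℝ) where
  carrier := {v | ∀ t : ℝ, proj n (t • v) ∈ Γ}
  add_mem' {v w} hv hw t := by
    rw [smul_add, map_add]; exact Γ.add_mem (hv t) (hw t)
  zero_mem' t := by simp
  smul_mem' c v hv t := by rw [smul_smul]; exact hv _

theorem proj_mem_of_mem_lineal {Γ : AddSubgroup (Torus n)} {v : Fin n → ℝ} (h : v ∈ lineal Γ) :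
    proj n v ∈ Γ := by simpa using h 1

theorem lineal_mono {Γ Δ : AddSubgroup (Torus n)} (h : Γ ≤ Δ) : lineal Γ ≤ lineal Δ :=
  fun _ hv t => h (hv t)

/-- Points of a closed subgroup near `0` lie on its linear part. -/
theorem exists_lineal_nhds {Γ : AddSubgroup (Torus n)} (hΓ : IsClosed (Γ : Set (Torus n))) :
    ∃ δ > 0, ∀ w : Fin n → ℝ, ‖w‖ < δ → proj n w ∈ Γ → w ∈ lineal Γ := by
  by_contra! hcon
  -- Subtracting a nearest point of the linear part leaves a vector whose distance to that part is
  -- its full norm.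
  have hz : ∀ k : ℕ, ∃ z : Fin n → ℝ, ‖z‖ < 1 / ((k : ℝ) + 1) ∧ proj n z ∈ Γ ∧ z ≠ 0 ∧
      ∀ v ∈ lineal Γ, ‖z‖ ≤ ‖z - v‖ := by
    intro k
    obtain ⟨w, hw, hwΓ, hwV⟩ := hcon (1 / ((k : ℝ) + 1)) (by positivity)
    obtain ⟨v, hv, hvd⟩ := (Submodule.closed_of_finiteDimensional (lineal Γ)).exists_infDist_eq_dist
      ⟨0, (lineal Γ).zero_mem⟩ w
    have hmin : ∀ u ∈ lineal Γ, ‖w - v‖ ≤ ‖w - u‖ := by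
      intro u hu
      rw [← dist_eq_norm, ← dist_eq_norm, ← hvd]
      exact Metric.infDist_le_dist_of_mem hu
    refine ⟨w - v, lt_of_le_of_lt (by simpa using hmin 0 (Submodule.zero_mem _)) hw, ?_, ?_, ?_⟩
    · rw [map_sub]; exact Γ.sub_mem hwΓ (proj_mem_of_mem_lineal hv)
    · intro h0
      exact hwV (by rwa [sub_eq_zero.1 h0])
    · intro u hu
      rw [sub_sub]
      exact hmin _ (Submodule.add_mem _ hv hu)
  choose z hz1 hzΓ hz0 hzV using hz
  have hsph : ∀ k, ‖z k‖⁻¹ • z k ∈ Metric.sphere (0 : Fin n → ℝ) 1 := fun k => by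
    rw [mem_sphere_zero_iff_norm, norm_smul, norm_inv, norm_norm,
      inv_mul_cancel₀ (norm_ne_zero_iff.2 (hz0 k))]
  obtain ⟨e, -, φ, hφ, hlim⟩ := (isCompact_sphere (0 : Fin n → ℝ) 1).tendsto_subseq hsph
  have hzlim : Tendsto (fun k => ‖z (φ k)‖) atTop (𝓝 0) :=
    squeeze_zero (fun _ => norm_nonneg _) (fun k => (hz1 _).le)
      (tendsto_one_div_add_atTop_nhds_zero_nat.comp hφ.tendsto_atTop)
  have heV : e ∈ lineal Γ := by
    intro t
    -- Integer multiples of the short vectors `z` stay in the preimage of `Γ` and become dense along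
    -- the limiting direction `e`.
    have hfl : Tendsto (fun k => (⌊t / ‖z (φ k)‖⌋ : ℝ) * ‖z (φ k)‖) atTop (𝓝 t) := by
      rw [tendsto_iff_dist_tendsto_zero]
      refine squeeze_zero (fun _ => dist_nonneg) (fun k => ?_) hzlim
      have hp : 0 < ‖z (φ k)‖ := norm_pos_iff.2 (hz0 _)
      have h1 := Int.floor_le (t / ‖z (φ k)‖)
      have h2 := (Int.lt_floor_add_one (t / ‖z (φ k)‖)).le
      rw [le_div_iff₀ hp] at h1
      rw [div_le_iff₀ hp] at h2
      rw [Real.dist_eq, abs_le]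
      constructor <;> nlinarith
    have hl2 := (continuous_proj (n := n)).continuousAt.tendsto.comp (hfl.smul hlim)
    refine hΓ.mem_of_tendsto hl2 (Eventually.of_forall fun k => ?_)
    have : ((⌊t / ‖z (φ k)‖⌋ : ℝ) * ‖z (φ k)‖) • (‖z (φ k)‖⁻¹ • z (φ k)) =
        (⌊t / ‖z (φ k)‖⌋ : ℤ) • z (φ k) := by
      rw [smul_smul, mul_assoc, mul_inv_cancel₀ (norm_ne_zero_iff.2 (hz0 _)), mul_one,
        Int.cast_smul_eq_zsmul]
    simp only [Function.comp_apply, this, map_zsmul]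
    exact Γ.zsmul_mem (hzΓ _) _
  have hge : ∀ k, 1 ≤ ‖‖z (φ k)‖⁻¹ • z (φ k) - e‖ := by
    intro k
    have hp : 0 < ‖z (φ k)‖ := norm_pos_iff.2 (hz0 _)
    have h1 := hzV (φ k) (‖z (φ k)‖ • e) (Submodule.smul_mem _ _ heV)
    have h2 : z (φ k) - ‖z (φ k)‖ • e = ‖z (φ k)‖ • (‖z (φ k)‖⁻¹ • z (φ k) - e) := by
      rw [smul_sub, smul_smul, mul_inv_cancel₀ hp.ne', one_smul]
    rw [h2, norm_smul, norm_norm] at h1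
    nlinarith
  have hl3 : Tendsto (fun k => ‖‖z (φ k)‖⁻¹ • z (φ k) - e‖) atTop (𝓝 0) :=
    tendsto_iff_norm_sub_tendsto_zero.1 hlim
  have := ge_of_tendsto' hl3 hge
  linarith

/-- The distance to a closed subgroup doubles under `y ↦ 2 y` close to the subgroup, so a subgroup
in a small neighbourhood of a closed subgroup is contained in it. -/
theorem exists_le_of_infDist_lt {Γ : AddSubgroup (Torus n)} (hΓ : IsClosed (Γ : Set (Torus n))) :
    ∃ δ > 0, ∀ Δ : AddSubgroup (Torus n),
      (∀ y ∈ Δ, Metric.infDist y (Γ : Set (Torus n)) < δ) → Δ ≤ Γ := by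
  obtain ⟨δ, hδ, hL⟩ := exists_lineal_nhds hΓ
  have hne : (Γ : Set (Torus n)).Nonempty := ⟨0, Γ.zero_mem⟩
  -- The vector `w + w - w2` is a combination of three lifts, each shorter than δ/4, so it stays
  -- within reach of `hL`.
  refine ⟨δ / 4, by positivity, fun Δ hΔ => ?_⟩
  have key : ∀ y ∈ Δ, 2 * Metric.infDist y (Γ : Set (Torus n)) ≤
      Metric.infDist (y + y) (Γ : Set (Torus n)) := by
    intro y hy
    obtain ⟨g, hg, hgd⟩ := hΓ.exists_infDist_eq_dist hne y
    obtain ⟨g2, hg2, hgd2⟩ := hΓ.exists_infDist_eq_dist hne (y + y)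
    obtain ⟨w, hw, hwn⟩ := exists_lift_norm (y - g)
    obtain ⟨w2, hw2, hwn2⟩ := exists_lift_norm (y + y - g2)
    have h1 := hΔ y hy
    have h2 := hΔ (y + y) (Δ.add_mem hy hy)
    rw [hgd, dist_eq_norm, ← hwn] at h1
    rw [hgd2, dist_eq_norm, ← hwn2] at h2
    have hz : w + w - w2 ∈ lineal Γ := by
      apply hL
      · calc ‖w + w - w2‖ ≤ ‖w + w‖ + ‖w2‖ := norm_sub_le _ _
          _ ≤ ‖w‖ + ‖w‖ + ‖w2‖ := by gcongr; exact norm_add_le _ _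
          _ < δ := by linarith
      · rw [map_sub, map_add, hw, hw2]
        have : y - g + (y - g) - (y + y - g2) = g2 - (g + g) := by abel
        rw [this]
        exact Γ.sub_mem hg2 (Γ.add_mem hg hg)
    -- Half of a vector in the linear part is still in it; adding it to `g` gives a point of `Γ` at
    -- distance at most ‖w2‖/2 from `y`.
    have hz' : (2⁻¹ : ℝ) • (w + w - w2) ∈ lineal Γ := Submodule.smul_mem _ _ hz
    have hle : Metric.infDist y (Γ : Set (Torus n)) ≤ ‖(2⁻¹ : ℝ) • w2‖ := by
      refine (Metric.infDist_le_dist_of_mem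
        (Γ.add_mem hg (proj_mem_of_mem_lineal hz'))).trans ?_
      rw [dist_eq_norm]
      have : y - (g + proj n ((2⁻¹ : ℝ) • (w + w - w2))) = proj n ((2⁻¹ : ℝ) • w2) := by
        have e : w - (2⁻¹ : ℝ) • (w + w - w2) = (2⁻¹ : ℝ) • w2 := by
          ext i; simp; ring
        rw [← e, map_sub, hw]; abel
      rw [this]
      exact norm_proj_le _
    rw [norm_smul, hwn2, ← dist_eq_norm, ← hgd2] at hle
    norm_num at hle
    linarith
  intro y hy
  have hpow : ∀ k : ℕ, ∃ z ∈ Δ, 2 ^ k * Metric.infDist y (Γ : Set (Torus n)) ≤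
      Metric.infDist z (Γ : Set (Torus n)) := by
    intro k
    induction k with
    | zero => exact ⟨y, hy, by simp⟩
    | succ k ih =>
      obtain ⟨z, hz, hle⟩ := ih
      exact ⟨z + z, Δ.add_mem hz hz, by rw [pow_succ]; linarith [key z hz]⟩
  rw [← SetLike.mem_coe, hΓ.mem_iff_infDist_zero hne]
  by_contra h0
  have hpos : 0 < Metric.infDist y (Γ : Set (Torus n)) :=
    lt_of_le_of_ne Metric.infDist_nonneg (Ne.symm h0)
  obtain ⟨k, hk⟩ := pow_unbounded_of_one_lt (δ / 4 / Metric.infDist y (Γ : Set (Torus n)))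
    (one_lt_two (α := ℝ))
  rw [div_lt_iff₀ hpos] at hk
  obtain ⟨z, hz, hle⟩ := hpow k
  linarith [hΔ z hz]

/-! ### Limits of subgroups along an ultrafilter -/

/-- The limit of a family of subgroups along a filter. -/
def limitSubgroup {ι : Type*} (l : Filter ι) (Δ : ι → AddSubgroup (Torus n)) :
    AddSubgroup (Torus n) where
  carrier := {x | ∀ ε > 0, ∀ᶠ j in l, ∃ y ∈ Δ j, dist x y < ε}
  add_mem' {x y} hx hy ε hε := by
    filter_upwards [hx (ε / 2) (by positivity), hy (ε / 2) (by positivity)]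
    rintro j ⟨a, ha, hxa⟩ ⟨b, hb, hyb⟩
    exact ⟨a + b, (Δ j).add_mem ha hb, by linarith [dist_add_add_le x y a b]⟩
  zero_mem' ε hε := Eventually.of_forall fun j => ⟨0, (Δ j).zero_mem, by simpa⟩
  neg_mem' {x} hx ε hε := by
    filter_upwards [hx ε hε]
    rintro j ⟨a, ha, hxa⟩
    exact ⟨-a, (Δ j).neg_mem ha, by rwa [dist_neg_neg]⟩

theorem isClosed_limitSubgroup {ι : Type*} (l : Filter ι) (Δ : ι → AddSubgroup (Torus n)) :
    IsClosed (limitSubgroup l Δ : Set (Torus n)) := by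
  rw [← closure_subset_iff_isClosed]
  intro x hx ε hε
  obtain ⟨z, hz, hxz⟩ := Metric.mem_closure_iff.1 hx (ε / 2) (by positivity)
  filter_upwards [hz (ε / 2) (by positivity)]
  rintro j ⟨y, hy, hzy⟩
  exact ⟨y, hy, by linarith [dist_triangle x z y]⟩

/-- Otherwise points at distance at least δ from the limit could be chosen on a set of the
ultrafilter; by compactness they converge, and their limit belongs to the limit subgroup. -/
theorem eventually_le_limitSubgroup {ι : Type*} (U : Ultrafilter ι)
    (Δ : ι → AddSubgroup (Torus n)) : ∀ᶠ j in U, Δ j ≤ limitSubgroup U Δ := by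
  obtain ⟨δ, hδ, h⟩ := exists_le_of_infDist_lt (isClosed_limitSubgroup (U : Filter ι) Δ)
  suffices ∀ᶠ j in U, ∀ y ∈ Δ j, Metric.infDist y (limitSubgroup U Δ : Set (Torus n)) < δ from
    this.mono fun j hj => h _ hj
  by_contra hcon
  rw [← Ultrafilter.eventually_not] at hcon
  -- The point 0 is a default at the indices where no far point exists.
  have hc : ∀ j, ∃ y ∈ Δ j, (¬ ∀ y ∈ Δ j, Metric.infDist y (limitSubgroup U Δ : Set (Torus n)) < δ) →
      δ ≤ Metric.infDist y (limitSubgroup U Δ : Set (Torus n)) := by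
    intro j
    by_cases hj : ∀ y ∈ Δ j, Metric.infDist y (limitSubgroup U Δ : Set (Torus n)) < δ
    · exact ⟨0, (Δ j).zero_mem, fun h => absurd hj h⟩
    · have hj2 := hj
      push Not at hj2
      obtain ⟨y, hy, hyd⟩ := hj2
      exact ⟨y, hy, fun _ => hyd⟩
  choose y hy hyd using hc
  obtain ⟨x, -, hx⟩ := isCompact_univ.ultrafilter_le_nhds (U.map y) (by simp)
  have hx' : Tendsto y U (𝓝 x) := hx
  have hxm : x ∈ limitSubgroup U Δ := by
    intro ε hε
    filter_upwards [(Metric.tendsto_nhds.1 hx') ε hε] with j hj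
    exact ⟨y j, hy j, by rwa [dist_comm]⟩
  obtain ⟨j, hj1, hj2⟩ := (((Metric.tendsto_nhds.1 hx') δ hδ).and hcon).exists
  have := hyd j hj2
  linarith [Metric.infDist_le_dist_of_mem (x := y j) hxm]

/-- The eventual inclusion gives one inequality; approximating an optimal point of the limit gives
the other. -/
theorem tendsto_D_limitSubgroup {ι : Type*} (U : Ultrafilter ι) (Δ : ι → AddSubgroup (Torus n)) :
    Tendsto (fun j => D (Δ j : Set (Torus n))) U (𝓝 (D (limitSubgroup U Δ : Set (Torus n)))) := by
  rw [Metric.tendsto_nhds]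
  intro ε hε
  obtain ⟨x, hx, hxd⟩ := (isClosed_limitSubgroup (U : Filter ι) Δ).exists_infDist_eq_dist
    ⟨0, AddSubgroup.zero_mem _⟩ (center n)
  filter_upwards [eventually_le_limitSubgroup U Δ, hx ε hε]
  rintro j hj ⟨y, hy, hxy⟩
  have h1 : D (limitSubgroup U Δ : Set (Torus n)) ≤ D (Δ j : Set (Torus n)) :=
    Metric.infDist_le_infDist_of_subset hj ⟨0, AddSubgroup.zero_mem _⟩
  have h2 : D (Δ j : Set (Torus n)) ≤ dist (center n) y := Metric.infDist_le_dist_of_mem hy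
  have h3 : D (limitSubgroup U Δ : Set (Torus n)) = dist (center n) x := hxd
  rw [Real.dist_eq, abs_lt]
  constructor <;> linarith [dist_triangle (center n) x y]

/-! ### Optimal points -/

theorem exists_norm_eq_D {Γ : AddSubgroup (Torus n)} (hΓ : IsClosed (Γ : Set (Torus n))) :
    ∃ a, center n + proj n a ∈ Γ ∧ ‖a‖ = D (Γ : Set (Torus n)) := by
  obtain ⟨x, hx, hxd⟩ := hΓ.exists_infDist_eq_dist ⟨0, Γ.zero_mem⟩ (center n)
  obtain ⟨a, ha, han⟩ := exists_lift_norm (x - center n)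
  refine ⟨a, ?_, ?_⟩
  · rw [ha, add_sub_cancel]; exact hx
  · rw [han, ← dist_eq_norm, dist_comm]; exact hxd.symm

theorem D_le_norm {Γ : AddSubgroup (Torus n)} {a : Fin n → ℝ} (ha : center n + proj n a ∈ Γ) :
    D (Γ : Set (Torus n)) ≤ ‖a‖ := by
  refine (Metric.infDist_le_dist_of_mem ha).trans ?_
  rw [dist_comm, dist_eq_norm, add_sub_cancel_left]
  exact norm_proj_le a

theorem D_anti {Γ Δ : AddSubgroup (Torus n)} (h : Δ ≤ Γ) :
    D (Γ : Set (Torus n)) ≤ D (Δ : Set (Torus n)) :=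
  Metric.infDist_le_infDist_of_subset h ⟨0, Δ.zero_mem⟩

theorem coord_ne_zero_of_norm_lt {a : Fin n → ℝ} (ha : ‖a‖ < 1 / 2) (i : Fin n) :
    (center n + proj n a) i ≠ 0 := by
  have h1 : |a i| < 1 / 2 := (norm_le_pi_norm a i).trans_lt ha
  rw [abs_lt] at h1
  intro h0
  have h2 : (center n + proj n a) i = ((1 / 2 + a i : ℝ) : UnitAddCircle) := rfl
  rw [h2, AddCircle.coe_eq_zero_iff] at h0
  obtain ⟨m, hm⟩ := h0
  simp only [zsmul_eq_mul, mul_one] at hm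
  have h3 : (0 : ℝ) < m := by linarith
  have h4 : (m : ℝ) < 1 := by linarith
  norm_cast at h3 h4
  omega

theorem isProper_iff (Γ : AddSubgroup (Torus n)) (hΓ : IsClosed (Γ : Set (Torus n))) :
    IsProper (Γ : Set (Torus n)) ↔ D (Γ : Set (Torus n)) < 1 / 2 := by
  constructor
  · intro h
    obtain ⟨x, hx, hx0⟩ := Set.not_subset.1 h
    simp only [Set.mem_iUnion, Set.mem_ofPred_eq, not_exists] at hx0
    refine (Metric.infDist_le_dist_of_mem hx).trans_lt ?_
    rw [dist_pi_lt_iff (by norm_num)]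
    intro i
    have h1 : ∃ r ∈ Set.Ico (0 : ℝ) (0 + 1), (r : UnitAddCircle) = x i := by
      obtain ⟨r, hr, h⟩ := (AddCircle.coe_image_Ico_eq (1 : ℝ) 0).symm ▸ Set.mem_univ (x i)
      exact ⟨r, hr, h⟩
    obtain ⟨r, ⟨hr0, hr1⟩, hr⟩ := h1
    have hrpos : 0 < r := by
      refine lt_of_le_of_ne hr0 fun h => hx0 i ?_
      rw [← hr, ← h]; rfl
    rw [← hr, dist_eq_norm]
    have h2 : center n i - (r : UnitAddCircle) = ((1 / 2 - r : ℝ) : UnitAddCircle) := rfl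
    rw [h2]
    refine lt_of_le_of_lt QuotientAddGroup.norm_mk_le_norm ?_
    rw [Real.norm_eq_abs, abs_lt]
    constructor <;> linarith
  · intro h hsub
    obtain ⟨a, ha, han⟩ := exists_norm_eq_D hΓ
    obtain ⟨i, hi⟩ := Set.mem_iUnion.1 (hsub ha)
    exact coord_ne_zero_of_norm_lt (han ▸ h) i hi

/-- Moving along the linear part cannot pull all extremal coordinates of an optimal point inwards. -/
theorem exists_tight_nonneg {Γ : AddSubgroup (Torus n)} {a v : Fin n → ℝ}
    (ha : center n + proj n a ∈ Γ) (had : ‖a‖ = D (Γ : Set (Torus n))) (hpos : 0 < ‖a‖)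
    (hv : v ∈ lineal Γ) : ∃ i, |a i| = ‖a‖ ∧ 0 ≤ a i * v i := by
  by_contra! hcon
  have hev : ∀ i, ∀ᶠ t in 𝓝[>] (0 : ℝ), |a i + t * v i| < ‖a‖ := by
    intro i
    rcases (norm_le_pi_norm a i).lt_or_eq with hlt | heq
    · have hc : Tendsto (fun t : ℝ => |a i + t * v i|) (𝓝[>] 0) (𝓝 |a i + 0 * v i|) :=
        (Continuous.tendsto (by fun_prop) 0).mono_left nhdsWithin_le_nhds
      rw [zero_mul, add_zero] at hc
      exact hc.eventually_lt_const hlt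
    · have hneg := hcon i heq
      rw [Real.norm_eq_abs] at heq
      -- This is the difference quotient ((aᵢ + t vᵢ)² − aᵢ²)/t, negative for small positive t.
      have hc : Tendsto (fun t : ℝ => 2 * (a i * v i) + t * v i ^ 2) (𝓝[>] 0)
          (𝓝 (2 * (a i * v i) + 0 * v i ^ 2)) :=
        (Continuous.tendsto (by fun_prop) 0).mono_left nhdsWithin_le_nhds
      filter_upwards [hc.eventually_lt_const (u := 0) (by linarith), self_mem_nhdsWithin]
        with t ht htp
      rw [← heq, ← sq_lt_sq]
      have : (0 : ℝ) < t := htp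
      nlinarith
  obtain ⟨t, ht⟩ := (eventually_all.2 hev).exists
  have h1 : ‖a + t • v‖ < ‖a‖ := (pi_norm_lt_iff hpos).2 fun i => by simpa using ht i
  have h2 : center n + proj n (a + t • v) ∈ Γ := by
    rw [map_add, ← add_assoc]; exact Γ.add_mem ha (hv t)
  linarith [D_le_norm h2]

/-- There is an optimal point that is isolated among the points of its translate of the linear
part with the same extremal coordinates. -/
theorem exists_extreme {Γ : AddSubgroup (Torus n)} (hΓ : IsClosed (Γ : Set (Torus n))) :
    ∃ a, center n + proj n a ∈ Γ ∧ ‖a‖ = D (Γ : Set (Torus n)) ∧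
      ∀ v ∈ lineal Γ, (∀ i, |a i| = ‖a‖ → v i = 0) → v = 0 := by
  obtain ⟨b, hb, hbd⟩ := exists_norm_eq_D hΓ
  set P : Set (Fin n → ℝ) := Metric.closedBall 0 ‖b‖ ∩ (fun a => a - b) ⁻¹' (lineal Γ) with hP
  have hPc : IsCompact P := (isCompact_closedBall _ _).inter_right
    ((Submodule.closed_of_finiteDimensional (lineal Γ)).preimage (by fun_prop))
  have hmem : ∀ a ∈ P, center n + proj n a ∈ Γ ∧ ‖a‖ = D (Γ : Set (Torus n)) := by
    rintro a ⟨ha1, ha2⟩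
    have h1 : center n + proj n a ∈ Γ := by
      have h := Γ.add_mem hb (proj_mem_of_mem_lineal ha2)
      rwa [map_sub, add_assoc, add_sub_cancel] at h
    refine ⟨h1, le_antisymm ?_ (D_le_norm h1)⟩
    rw [← hbd]; simpa using ha1
  obtain ⟨a, haP, hext⟩ := hPc.extremePoints_nonempty ⟨b, by simp [hP]⟩
  obtain ⟨haΓ, had⟩ := hmem a haP
  refine ⟨a, haΓ, had, fun v hv hv0 => ?_⟩
  -- If `v` vanishes on the extremal coordinates, then a ± tv both stay in `P` for small t, so
  -- extremality of `a` forces `v = 0`.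
  have hev : ∀ i, ∀ᶠ t in 𝓝[>] (0 : ℝ), |a i + t * v i| ≤ ‖a‖ ∧ |a i - t * v i| ≤ ‖a‖ := by
    intro i
    rcases (norm_le_pi_norm a i).lt_or_eq with hlt | heq
    · have hc : ∀ s : ℝ, Tendsto (fun t : ℝ => |a i + s * (t * v i)|) (𝓝[>] 0)
          (𝓝 |a i + s * (0 * v i)|) := fun s =>
        (Continuous.tendsto (by fun_prop) 0).mono_left nhdsWithin_le_nhds
      simp only [zero_mul, mul_zero, add_zero] at hc
      filter_upwards [(hc 1).eventually_lt_const hlt, (hc (-1)).eventually_lt_const hlt]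
        with t h1 h2
      constructor
      · simpa using h1.le
      · simpa [sub_eq_add_neg] using h2.le
    · simp [hv0 i heq, norm_le_pi_norm a i, ← Real.norm_eq_abs]
  obtain ⟨t, ht, htp⟩ := ((eventually_all.2 hev).and self_mem_nhdsWithin).exists
  have htp : (0 : ℝ) < t := htp
  have hab : ‖a‖ = ‖b‖ := had.trans hbd.symm
  have hin : ∀ s : ℝ, (∀ i, |a i + s * v i| ≤ ‖a‖) → a + s • v ∈ P := by
    intro s hs
    refine ⟨?_, ?_⟩
    · rw [mem_closedBall_zero_iff, ← hab]
      exact (pi_norm_le_iff_of_nonneg (norm_nonneg _)).2 fun i => by simpa using hs i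
    · have : a + s • v - b = (a - b) + s • v := by abel
      rw [Set.mem_preimage, this]
      exact Submodule.add_mem _ haP.2 (Submodule.smul_mem _ _ hv)
  have h1 := hin t fun i => (ht i).1
  have h2 := hin (-t) fun i => by simpa [sub_eq_add_neg] using (ht i).2
  have h3 := hext h1 h2 ⟨1 / 2, 1 / 2, by norm_num, by norm_num, by norm_num, by
    ext i; simp; ring⟩
  have h4 : t • v = 0 := by simpa using h3
  exact (smul_eq_zero.1 h4).resolve_left htp.ne'

/-! ### Torsion and rationality -/

theorem exists_nsmul_norm_lt (x : Torus n) {ε : ℝ} (hε : 0 < ε) :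
    ∃ k : ℕ, 0 < k ∧ ‖k • x‖ < ε := by
  obtain ⟨y, -, φ, hφ, hlim⟩ := isCompact_univ.tendsto_subseq
    (x := fun k : ℕ => k • x) fun _ => Set.mem_univ _
  obtain ⟨N, hN⟩ := Metric.cauchySeq_iff'.1 hlim.cauchySeq ε hε
  have hlt : φ N < φ (N + 1) := hφ (Nat.lt_succ_self N)
  refine ⟨φ (N + 1) - φ N, by omega, ?_⟩
  have h := hN (N + 1) (Nat.le_succ N)
  simp only [Function.comp_apply, dist_eq_norm] at h
  rwa [sub_nsmul _ hlt.le, ← sub_eq_add_neg]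

theorem exists_nsmul_eq_zero_of_lineal_eq_bot {Γ : AddSubgroup (Torus n)}
    (hΓ : IsClosed (Γ : Set (Torus n))) (h0 : ∀ v ∈ lineal Γ, v = 0) {x : Torus n} (hx : x ∈ Γ) :
    ∃ k : ℕ, 0 < k ∧ k • x = 0 := by
  obtain ⟨δ, hδ, hL⟩ := exists_lineal_nhds hΓ
  obtain ⟨k, hk, hkx⟩ := exists_nsmul_norm_lt x hδ
  refine ⟨k, hk, ?_⟩
  obtain ⟨w, hw, hwn⟩ := exists_lift_norm (k • x)
  have : w = 0 := h0 w (hL w (by rwa [hwn]) (hw ▸ Γ.nsmul_mem hx k))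
  rw [← hw, this, map_zero]

theorem exists_int_mem_lineal {Γ : AddSubgroup (Torus n)} (hΓ : IsClosed (Γ : Set (Torus n)))
    {e : Fin n → ℝ} (he : e ∈ lineal Γ) (he0 : e ≠ 0) :
    ∃ u : Fin n → ℤ, (fun i => (u i : ℝ)) ∈ lineal Γ ∧ (fun i => (u i : ℝ)) ≠ 0 := by
  obtain ⟨δ, hδ, hL⟩ := exists_lineal_nhds hΓ
  have hep : 0 < ‖e‖ := norm_pos_iff.2 he0
  -- With norm exactly δ, every positive multiple of `f` is longer than the remainder `w`, so the
  -- integer vector k•f − w is nonzero.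
  set f : Fin n → ℝ := (δ / ‖e‖) • e with hf
  have hfV : f ∈ lineal Γ := Submodule.smul_mem _ _ he
  have hfn : ‖f‖ = δ := by
    rw [hf, norm_smul, Real.norm_of_nonneg (by positivity), div_mul_cancel₀ _ hep.ne']
  obtain ⟨k, hk, hkx⟩ := exists_nsmul_norm_lt (proj n f) hδ
  obtain ⟨w, hw, hwn⟩ := exists_lift_norm (k • proj n f)
  have hwV : w ∈ lineal Γ := hL w (by rwa [hwn])
    (hw ▸ Γ.nsmul_mem (proj_mem_of_mem_lineal hfV) k)
  obtain ⟨u, hu⟩ := (proj_eq_zero_iff (k • f - w)).1 (by rw [map_sub, map_nsmul, hw, sub_self])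
  refine ⟨u, ?_, ?_⟩
  · rw [← hu]; exact Submodule.sub_mem _ (Submodule.smul_of_tower_mem _ k hfV) hwV
  · rw [← hu, sub_ne_zero]
    intro h
    have h1 : ‖k • f‖ < δ := by rw [h, hwn]; exact hkx
    rw [← Nat.cast_smul_eq_nsmul ℝ, norm_smul, hfn, Real.norm_natCast] at h1
    have : (1 : ℝ) ≤ k := by exact_mod_cast hk
    nlinarith

theorem two_nsmul_center : (2 : ℕ) • center n = 0 := by
  rw [center, ← map_nsmul, proj_eq_zero_iff]
  exact ⟨fun _ => 1, by ext i; simp⟩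

theorem sign_smul_center_apply {s : ℤ} (hs : s = 1 ∨ s = -1) (i : Fin n) :
    s • center n i = center n i := by
  rcases hs with rfl | rfl
  · exact one_zsmul _
  · rw [neg_one_zsmul, neg_eq_iff_add_eq_zero, ← two_nsmul]
    exact congrFun (two_nsmul_center (n := n)) i

/-- The subgroup of the points of `Γ` whose coordinates in `I` agree up to the signs `s`. -/
def signedDiagonal (Γ : AddSubgroup (Torus n)) (I : Set (Fin n)) (s : Fin n → ℤ) :
    AddSubgroup (Torus n) where
  carrier := {y | y ∈ Γ ∧ ∀ i ∈ I, ∀ j ∈ I, s i • y i = s j • y j}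
  add_mem' {x y} hx hy := ⟨Γ.add_mem hx.1 hy.1, fun i hi j hj => by
    simp only [Pi.add_apply, smul_add, hx.2 i hi j hj, hy.2 i hi j hj]⟩
  zero_mem' := ⟨Γ.zero_mem, by simp⟩
  neg_mem' {x} hx := ⟨Γ.neg_mem hx.1, fun i hi j hj => by
    simp only [Pi.neg_apply, smul_neg, hx.2 i hi j hj]⟩

theorem isClosed_signedDiagonal {Γ : AddSubgroup (Torus n)} (hΓ : IsClosed (Γ : Set (Torus n)))
    (I : Set (Fin n)) (s : Fin n → ℤ) : IsClosed (signedDiagonal Γ I s : Set (Torus n)) := by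
  have : (signedDiagonal Γ I s : Set (Torus n)) =
      (Γ : Set (Torus n)) ∩ ⋂ i ∈ I, ⋂ j ∈ I, {y | s i • y i = s j • y j} := by
    ext y
    simp only [Set.mem_inter_iff, Set.mem_iInter, Set.mem_ofPred_eq]
    rfl
  rw [this]
  refine hΓ.inter (isClosed_biInter fun i _ => isClosed_biInter fun j _ => ?_)
  exact isClosed_eq ((continuous_apply i).zsmul _) ((continuous_apply j).zsmul _)

theorem eq_of_forall_smul_coe_eq {a b : ℝ}
    (h : ∀ t : ℝ, ((t * a : ℝ) : UnitAddCircle) = ((t * b : ℝ) : UnitAddCircle)) : a = b := by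
  by_contra hne
  have h1 := h (1 / (2 * (a - b)))
  have h2 : ((1 / (2 * (a - b)) * a - 1 / (2 * (a - b)) * b : ℝ) : UnitAddCircle) = 0 := by
    rw [AddCircle.coe_sub, h1, sub_self]
  have h3 : 1 / (2 * (a - b)) * a - 1 / (2 * (a - b)) * b = 1 / 2 := by
    have : a - b ≠ 0 := sub_ne_zero.2 hne
    field_simp
  rw [h3, AddCircle.coe_eq_zero_iff] at h2
  obtain ⟨m, hm⟩ := h2
  simp only [zsmul_eq_mul, mul_one] at hm
  have : (2 * m : ℝ) = 1 := by linarith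
  norm_cast at this
  omega

/-- After sign changes all extremal coordinates of the point agree, so it lies in a signed diagonal
of `Γ`. A direction in the linear part of that diagonal moves all extremal coordinates outwards or
all inwards at the same rate; optimality makes the rate 0 and extremality kills the direction. A
closed subgroup with trivial linear part is torsion. -/
theorem exists_torsion_of_extreme {Γ : AddSubgroup (Torus n)} (hΓ : IsClosed (Γ : Set (Torus n)))
    {a : Fin n → ℝ} (ha : center n + proj n a ∈ Γ) (had : ‖a‖ = D (Γ : Set (Torus n)))
    (hext : ∀ v ∈ lineal Γ, (∀ i, |a i| = ‖a‖ → v i = 0) → v = 0) :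
    ∃ k : ℕ, 0 < k ∧ k • (center n + proj n a) = 0 := by
  rcases (norm_nonneg a).eq_or_lt with h0 | hpos
  · refine ⟨2, by norm_num, ?_⟩
    rw [norm_eq_zero.1 h0.symm, map_zero, add_zero, two_nsmul_center]
  classical
  set s : Fin n → ℤ := fun i => if 0 ≤ a i then 1 else -1 with hs
  have hs1 : ∀ i, s i = 1 ∨ s i = -1 := fun i => by simp only [hs]; split_ifs <;> simp
  have hsa : ∀ i, (s i : ℝ) * a i = |a i| := by
    intro i
    simp only [hs]
    split_ifs with h
    · simp [abs_of_nonneg h]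
    · simp [abs_of_neg (not_le.1 h)]
  have hss : ∀ i, (s i : ℝ) * s i = 1 := fun i => by rcases hs1 i with h | h <;> simp [h]
  set I : Set (Fin n) := {i | |a i| = ‖a‖} with hI
  refine exists_nsmul_eq_zero_of_lineal_eq_bot (isClosed_signedDiagonal hΓ I s) ?_ ⟨ha, ?_⟩
  · intro v hv
    have hvΓ : v ∈ lineal Γ := fun t => (hv t).1
    have heq : ∀ i ∈ I, ∀ j ∈ I, (s i : ℝ) * v i = s j * v j := by
      intro i hi j hj
      refine eq_of_forall_smul_coe_eq fun t => ?_
      have := (hv t).2 i hi j hj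
      have hc : ∀ i, s i • proj n (t • v) i = ((t * (s i * v i) : ℝ) : UnitAddCircle) := by
        intro i
        rw [proj_apply, ← AddCircle.coe_zsmul]
        congr 1
        simp; ring
      rwa [hc, hc] at this
    have hav : ∀ i ∈ I, a i * v i = ‖a‖ * (s i * v i) := by
      intro i hi
      have h1 : |a i| = ‖a‖ := hi
      rw [← h1, ← hsa i]
      linear_combination (-(a i * v i)) * hss i
    obtain ⟨i, hi, hi0⟩ := exists_tight_nonneg ha had hpos hvΓ
    obtain ⟨j, hj, hj0⟩ := exists_tight_nonneg ha had hpos (Submodule.neg_mem _ hvΓ)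
    rw [hav i hi] at hi0
    rw [Pi.neg_apply, mul_neg, hav j hj, heq j hj i hi] at hj0
    have hz : (s i : ℝ) * v i = 0 := by
      have : ‖a‖ * ((s i : ℝ) * v i) = 0 := by linarith
      exact (mul_eq_zero.1 this).resolve_left hpos.ne'
    refine hext v hvΓ fun k hk => ?_
    have h1 := heq k hk i hi
    rw [hz] at h1
    have h2 := hss k
    calc v k = s k * (s k * v k) := by linear_combination (-(v k)) * h2
      _ = 0 := by rw [h1, mul_zero]
  · have hc : ∀ i ∈ I, s i • (center n + proj n a) i = center n i + ((‖a‖ : ℝ) : UnitAddCircle) := by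
      intro i hi
      have h1 : |a i| = ‖a‖ := hi
      rw [Pi.add_apply, smul_add, sign_smul_center_apply (hs1 i), proj_apply,
        ← AddCircle.coe_zsmul, ← h1, ← hsa i]
      simp
    intro i hi j hj
    rw [hc i hi, hc j hj]
    rfl

/-! ### Lines and one-dimensional closed subgroups -/

/-- The subgroup `π(ℝu)` for an integer vector `u`. -/
noncomputable def lineTorus (u : Fin n → ℤ) : AddSubgroup (Torus n) :=
  (Submodule.span ℝ {fun i => (u i : ℝ)}).toAddSubgroup.map (proj n)

theorem mem_lineTorus {u : Fin n → ℤ} {x : Torus n} :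
    x ∈ lineTorus u ↔ ∃ t : ℝ, proj n (t • fun i => (u i : ℝ)) = x := by
  simp only [lineTorus, AddSubgroup.mem_map, Submodule.mem_toAddSubgroup,
    Submodule.mem_span_singleton]
  constructor
  · rintro ⟨_, ⟨t, rfl⟩, h⟩; exact ⟨t, h⟩
  · rintro ⟨t, h⟩; exact ⟨_, ⟨t, rfl⟩, h⟩

theorem isSubtorus_one_iff {T : AddSubgroup (Torus n)} :
    IsSubtorus 1 T ↔ ∃ u : Fin n → ℤ, (fun i => (u i : ℝ)) ≠ 0 ∧ T = lineTorus u := by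
  constructor
  · rintro ⟨u, hu, rfl⟩
    refine ⟨u 0, hu.ne_zero 0, ?_⟩
    simp only [lineTorus, Set.range_unique]
    rfl
  · rintro ⟨u, hu, rfl⟩
    refine ⟨fun _ => u, ?_, ?_⟩
    · exact linearIndependent_unique_iff.2 hu
    · simp only [lineTorus, Set.range_const]

theorem lineTorus_le_iff {u : Fin n → ℤ} {Γ : AddSubgroup (Torus n)} :
    lineTorus u ≤ Γ ↔ (fun i => (u i : ℝ)) ∈ lineal Γ := by
  constructor
  · exact fun h t => h (mem_lineTorus.2 ⟨t, rfl⟩)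
  · intro h x hx
    obtain ⟨t, rfl⟩ := mem_lineTorus.1 hx
    exact h t

theorem isCompact_lineTorus (u : Fin n → ℤ) : IsCompact (lineTorus u : Set (Torus n)) := by
  have : (lineTorus u : Set (Torus n)) =
      (fun t : ℝ => proj n (t • fun i => (u i : ℝ))) '' Set.Icc 0 1 := by
    ext x
    rw [SetLike.mem_coe, mem_lineTorus]
    constructor
    · rintro ⟨t, rfl⟩
      refine ⟨Int.fract t, ⟨Int.fract_nonneg t, (Int.fract_lt_one t).le⟩, ?_⟩
      rw [← sub_eq_zero, ← map_sub, proj_eq_zero_iff]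
      refine ⟨fun i => -⌊t⌋ * u i, ?_⟩
      ext i
      simp only [Pi.sub_apply, Pi.smul_apply, smul_eq_mul, Int.fract]
      push_cast
      ring
    · rintro ⟨t, -, rfl⟩; exact ⟨t, rfl⟩
  rw [this]
  exact isCompact_Icc.image (continuous_proj.comp (by fun_prop))

theorem isClosed_lineTorus (u : Fin n → ℤ) : IsClosed (lineTorus u : Set (Torus n)) :=
  (isCompact_lineTorus u).isClosed

theorem mem_S_iff {d : ℝ} : d ∈ S n ↔ ∃ u : Fin n → ℤ, (fun i => (u i : ℝ)) ≠ 0 ∧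
    D (lineTorus u : Set (Torus n)) < 1 / 2 ∧ D (lineTorus u : Set (Torus n)) = d := by
  constructor
  · rintro ⟨T, hT, hp, rfl⟩
    obtain ⟨u, hu, rfl⟩ := isSubtorus_one_iff.1 hT
    exact ⟨u, hu, (isProper_iff _ (isClosed_lineTorus u)).1 hp, rfl⟩
  · rintro ⟨u, hu, hp, rfl⟩
    exact ⟨_, isSubtorus_one_iff.2 ⟨u, hu, rfl⟩, (isProper_iff _ (isClosed_lineTorus u)).2 hp, rfl⟩

theorem exists_nsmul_mem_lineTorus_eq {u : Fin n → ℤ} {k : ℕ} (hk : 0 < k) {x : Torus n}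
    (hx : x ∈ lineTorus u) : ∃ y ∈ lineTorus u, k • y = x := by
  obtain ⟨t, rfl⟩ := mem_lineTorus.1 hx
  refine ⟨_, mem_lineTorus.2 ⟨t / k, rfl⟩, ?_⟩
  have : (k : ℝ) ≠ 0 := by positivity
  rw [← map_nsmul, ← Nat.cast_smul_eq_nsmul ℝ, smul_smul, mul_div_cancel₀ _ this]

/-- A one-dimensional subtorus and a torsion point generate a one-dimensional closed subgroup. -/
theorem isClosedSubgroupOfDim_sup_zmultiples {u : Fin n → ℤ} (hu : (fun i => (u i : ℝ)) ≠ 0)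
    {x : Torus n} (hx : ∃ k : ℕ, 0 < k ∧ k • x = 0) :
    IsClosedSubgroupOfDim 1 (lineTorus u ⊔ AddSubgroup.zmultiples x) := by
  classical
  -- Take the least k with k•x on the line. Divisibility of the line gives `y` on it with k•y = k•x;
  -- by minimality, x − y generates a finite complement.
  have hex : ∃ k : ℕ, 0 < k ∧ k • x ∈ lineTorus u := by
    obtain ⟨k, hk, h⟩ := hx
    exact ⟨k, hk, by rw [h]; exact zero_mem _⟩
  obtain ⟨hk, hkx⟩ := Nat.find_spec hex
  set k := Nat.find hex
  obtain ⟨y, hy, hyx⟩ := exists_nsmul_mem_lineTorus_eq hk hkx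
  have hkz : k • (x - y) = 0 := by rw [nsmul_sub, hyx, sub_self]
  have hfin : IsOfFinAddOrder (x - y) := isOfFinAddOrder_iff_nsmul_eq_zero.2 ⟨k, hk, hkz⟩
  have hHfin : (AddSubgroup.zmultiples (x - y) : Set (Torus n)).Finite :=
    hfin.finite_zmultiples
  have hsup : lineTorus u ⊔ AddSubgroup.zmultiples (x - y) =
      lineTorus u ⊔ AddSubgroup.zmultiples x := by
    refine le_antisymm (sup_le le_sup_left ?_) (sup_le le_sup_left ?_)
    · rw [AddSubgroup.zmultiples_le]
      exact sub_mem (AddSubgroup.mem_sup_right (AddSubgroup.mem_zmultiples x))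
        (AddSubgroup.mem_sup_left hy)
    · rw [AddSubgroup.zmultiples_le]
      have := add_mem (AddSubgroup.mem_sup_right (S := lineTorus u)
        (AddSubgroup.mem_zmultiples (x - y)))
        (AddSubgroup.mem_sup_left (T := AddSubgroup.zmultiples (x - y)) hy)
      rwa [sub_add_cancel] at this
  refine ⟨?_, lineTorus u, AddSubgroup.zmultiples (x - y), isSubtorus_one_iff.2 ⟨u, hu, rfl⟩,
    hHfin, ?_, hsup⟩
  · rw [← hsup, AddSubgroup.add_normal]
    exact ((isCompact_lineTorus u).add hHfin.isCompact).isClosed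
  · rw [eq_bot_iff]
    rintro z ⟨hz1, hz2⟩
    obtain ⟨j, rfl⟩ := AddSubgroup.mem_zmultiples_iff.1 hz2
    have hjx : j • x ∈ lineTorus u := by
      have := add_mem (show j • (x - y) ∈ lineTorus u from hz1) (zsmul_mem hy j)
      rwa [← zsmul_add, sub_add_cancel] at this
    have hmod : (j % (k : ℤ)) • x ∈ lineTorus u := by
      rw [Int.emod_def, sub_zsmul, ← sub_eq_add_neg]
      refine sub_mem hjx ?_
      rw [mul_comm, mul_zsmul, natCast_zsmul]
      exact zsmul_mem hkx _
    have hk' : (0 : ℤ) < k := by exact_mod_cast hk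
    have hr0 := Int.emod_nonneg j hk'.ne'
    have hrlt := Int.emod_lt_of_pos j hk'
    have hr : j % (k : ℤ) = 0 := by
      by_contra hne
      have h1 := Nat.find_min hex (m := (j % (k : ℤ)).toNat) (by omega)
      apply h1
      refine ⟨by omega, ?_⟩
      rwa [← natCast_zsmul, Int.toNat_of_nonneg hr0]
    obtain ⟨c, hc⟩ := Int.dvd_of_emod_eq_zero hr
    show j • (x - y) = 0
    rw [hc, mul_comm, mul_zsmul, natCast_zsmul, hkz, zsmul_zero]

/-- An integer line inside `Γ` and a torsion optimal point generate a one-dimensional closed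
subgroup of `Γ` that keeps the optimal point. -/
theorem D_mem_SStar {Γ : AddSubgroup (Torus n)} (hΓ : IsClosed (Γ : Set (Torus n)))
    (hD : D (Γ : Set (Torus n)) < 1 / 2) {e : Fin n → ℝ} (he : e ∈ lineal Γ) (he0 : e ≠ 0) :
    D (Γ : Set (Torus n)) ∈ SStar n := by
  obtain ⟨u, huΓ, hu⟩ := exists_int_mem_lineal hΓ he he0
  obtain ⟨a, ha, had, hext⟩ := exists_extreme hΓ
  have hdim := isClosedSubgroupOfDim_sup_zmultiples hu
    (exists_torsion_of_extreme hΓ ha had hext)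
  have hle : lineTorus u ⊔ AddSubgroup.zmultiples (center n + proj n a) ≤ Γ :=
    sup_le (lineTorus_le_iff.2 huΓ) (by rwa [AddSubgroup.zmultiples_le])
  have heq : D ((lineTorus u ⊔ AddSubgroup.zmultiples (center n + proj n a) :
      AddSubgroup (Torus n)) : Set (Torus n)) = D (Γ : Set (Torus n)) := by
    refine le_antisymm ?_ (D_anti hle)
    rw [← had]
    exact D_le_norm (AddSubgroup.mem_sup_right (AddSubgroup.mem_zmultiples _))
  exact ⟨_, hdim, (isProper_iff _ hdim.1).2 (heq ▸ hD), heq⟩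

theorem exists_of_mem_SStar {d : ℝ} (hd : d ∈ SStar n) : ∃ Γ : AddSubgroup (Torus n),
    IsClosed (Γ : Set (Torus n)) ∧ D (Γ : Set (Torus n)) < 1 / 2 ∧
    D (Γ : Set (Torus n)) = d ∧ ∃ e ∈ lineal Γ, e ≠ 0 := by
  obtain ⟨Γ, ⟨hcl, T, H, hT, -, -, rfl⟩, hp, hD⟩ := hd
  obtain ⟨u, hu, rfl⟩ := isSubtorus_one_iff.1 hT
  exact ⟨_, hcl, (isProper_iff _ hcl).1 hp, hD, _, lineTorus_le_iff.1 le_sup_left, hu⟩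

theorem S_subset_SStar : S n ⊆ SStar n := by
  intro d hd
  obtain ⟨u, hu, hD, rfl⟩ := mem_S_iff.1 hd
  exact D_mem_SStar (isClosed_lineTorus u) hD (lineTorus_le_iff.1 le_rfl) hu

theorem D_nonneg (X : Set (Torus n)) : 0 ≤ D X := Metric.infDist_nonneg

theorem nonneg_of_mem_SStar {d : ℝ} (hd : d ∈ SStar n) : 0 ≤ d := by
  obtain ⟨Γ, -, -, rfl, -⟩ := exists_of_mem_SStar hd
  exact D_nonneg _

theorem zero_mem_S_one : (0 : ℝ) ∈ S 1 := by
  refine mem_S_iff.2 ⟨fun _ => 1, ?_⟩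
  have h : D (lineTorus (fun _ : Fin 1 => (1 : ℤ)) : Set (Torus 1)) = 0 := by
    refine le_antisymm ?_ (D_nonneg _)
    rw [← norm_zero (E := Fin 1 → ℝ)]
    refine D_le_norm (mem_lineTorus.2 ⟨1 / 2, ?_⟩)
    rw [map_zero, add_zero, center]
    congr 1
    ext i
    simp
  refine ⟨fun h0 => ?_, by rw [h]; norm_num, h⟩
  simpa using congrFun h0 0

theorem SStar_one_subset : SStar 1 ⊆ {0} := by
  intro d hd
  obtain ⟨Γ, -, -, rfl, e, he, he0⟩ := exists_of_mem_SStar hd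
  refine le_antisymm ?_ (D_nonneg _)
  have h0 : e 0 ≠ 0 := fun h => he0 (funext fun i => by rw [Subsingleton.elim i 0, h]; rfl)
  rw [← norm_zero (E := Fin 1 → ℝ)]
  refine D_le_norm ?_
  have h1 := he (1 / (2 * e 0))
  have h2 : (1 / (2 * e 0)) • e = fun _ => 1 / 2 := by
    ext i
    rw [Subsingleton.elim i 0, Pi.smul_apply, smul_eq_mul]
    field_simp
  rw [h2] at h1
  rwa [map_zero, add_zero]

/-! ### Lowering the ambient dimension by identifying two coordinates -/

/-- The homomorphism of tori that reads coordinate `i` of the image from coordinate `f i`, with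
sign `s i`. -/
noncomputable def pullTorus {m : ℕ} (f : Fin n → Fin m) (s : Fin n → ℤ) : Torus m →+ Torus n where
  toFun y i := s i • y (f i)
  map_zero' := by ext i; simp
  map_add' x y := by ext i; simp

/-- The linear lift of `pullTorus`. -/
noncomputable def pullVec {m : ℕ} (f : Fin n → Fin m) (s : Fin n → ℤ) : (Fin m → ℝ) →ₗ[ℝ] (Fin n → ℝ) where
  toFun y i := s i * y (f i)
  map_add' x y := by ext i; simp [mul_add]
  map_smul' c y := by ext i; simp; ring

theorem proj_pullVec {m : ℕ} (f : Fin n → Fin m) (s : Fin n → ℤ) (v : Fin m → ℝ) :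
    proj n (pullVec f s v) = pullTorus f s (proj m v) := by
  ext i
  show ((s i * v (f i) : ℝ) : UnitAddCircle) = s i • ((v (f i) : ℝ) : UnitAddCircle)
  rw [← AddCircle.coe_zsmul, zsmul_eq_mul]

theorem pullTorus_center {m : ℕ} (f : Fin n → Fin m) {s : Fin n → ℤ}
    (hs : ∀ i, s i = 1 ∨ s i = -1) : pullTorus f s (center m) = center n := by
  ext i
  exact sign_smul_center_apply (hs i) (f i)

theorem norm_pullVec {m : ℕ} {f : Fin n → Fin m} (hf : Function.Surjective f) {s : Fin n → ℤ}
    (hs : ∀ i, s i = 1 ∨ s i = -1) (v : Fin m → ℝ) : ‖pullVec f s v‖ = ‖v‖ := by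
  have h : ∀ i, ‖pullVec f s v i‖ = ‖v (f i)‖ := by
    intro i
    show ‖(s i : ℝ) * v (f i)‖ = _
    rcases hs i with h | h <;> simp [h]
  refine le_antisymm ?_ ?_ <;> refine (pi_norm_le_iff_of_nonneg (norm_nonneg _)).2 fun i => ?_
  · rw [h]; exact norm_le_pi_norm v _
  · obtain ⟨k, rfl⟩ := hf i
    rw [← h]; exact norm_le_pi_norm _ k

theorem continuous_pullTorus {m : ℕ} (f : Fin n → Fin m) (s : Fin n → ℤ) :
    Continuous (pullTorus f s) :=
  continuous_pi fun i => (continuous_apply (f i)).zsmul (s i)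

/-- A plane meets the kernel of every linear functional. -/
theorem exists_ne_zero_map_eq_zero {E : Type*} [AddCommGroup E] [Module ℝ E]
    {V : Submodule ℝ E} {u w : E} (hu : u ∈ V) (hw : w ∈ V) (hu0 : u ≠ 0)
    (hwu : w ∉ Submodule.span ℝ {u}) (φ : E →ₗ[ℝ] ℝ) : ∃ v ∈ V, v ≠ 0 ∧ φ v = 0 := by
  by_cases h : φ u = 0
  · exact ⟨u, hu, hu0, h⟩
  · refine ⟨φ u • w - φ w • u, sub_mem (V.smul_mem _ hw) (V.smul_mem _ hu), ?_, ?_⟩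
    · intro h0
      apply hwu
      rw [Submodule.mem_span_singleton]
      refine ⟨(φ u)⁻¹ * φ w, ?_⟩
      rw [mul_smul, ← sub_eq_zero.1 h0, smul_smul, inv_mul_cancel₀ h, one_smul]
    · simp [mul_comm]

/-- A proper closed subgroup of dimension at least two has its value in the spectrum of one
dimension less. -/
theorem D_mem_SStar_of_plane {Γ : AddSubgroup (Torus (n + 1))}
    (hΓ : IsClosed (Γ : Set (Torus (n + 1)))) (hD : D (Γ : Set (Torus (n + 1))) < 1 / 2)
    {u w : Fin (n + 1) → ℝ} (hu : u ∈ lineal Γ) (hw : w ∈ lineal Γ) (hu0 : u ≠ 0)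
    (hwu : w ∉ Submodule.span ℝ {u}) : D (Γ : Set (Torus (n + 1))) ∈ SStar n := by
  obtain ⟨a, ha, had, hext⟩ := exists_extreme hΓ
  -- With at most one extremal coordinate, the plane spanned by `u` and `w` would contain a nonzero
  -- vector vanishing there, against `hext`.
  have hpair : ∃ i j, i ≠ j ∧ |a i| = ‖a‖ ∧ |a j| = ‖a‖ := by
    by_contra! hcon
    have : ∃ i, ∀ j, |a j| = ‖a‖ → j = i := by
      by_cases h : ∃ i, |a i| = ‖a‖
      · obtain ⟨i, hi⟩ := h
        exact ⟨i, fun j hj => by_contra fun hne => hcon i j (Ne.symm hne) hi hj⟩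
      · exact ⟨0, fun j hj => absurd ⟨j, hj⟩ h⟩
    obtain ⟨i, hi⟩ := this
    obtain ⟨v, hv, hv0, hvi⟩ := exists_ne_zero_map_eq_zero hu hw hu0 hwu
      (LinearMap.proj i : (Fin (n + 1) → ℝ) →ₗ[ℝ] ℝ)
    exact hv0 (hext v hv fun j hj => by rw [hi j hj]; exact hvi)
  obtain ⟨i, j, hij, hi, hj⟩ := hpair
  obtain ⟨i', rfl⟩ := Fin.exists_succAbove_eq hij
  have hsign : ∃ σ : ℤ, (σ = 1 ∨ σ = -1) ∧ a j = σ * a (j.succAbove i') := by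
    rcases abs_eq_abs.1 (hj.trans hi.symm) with h | h
    · exact ⟨1, Or.inl rfl, by simp [h]⟩
    · exact ⟨-1, Or.inr rfl, by simp [h]⟩
  obtain ⟨σ, hσ, hja⟩ := hsign
  -- Coordinate `j` is dropped and recovered as σ times coordinate `j.succAbove i'`; this
  -- parametrizes the subtorus x_j = σ x_i, which contains the optimal point.
  set f : Fin (n + 1) → Fin n := j.insertNth (α := fun _ => Fin n) i' id with hf
  set s : Fin (n + 1) → ℤ := j.insertNth (α := fun _ => ℤ) σ (fun _ => 1) with hs
  have hfs : ∀ p, f (j.succAbove p) = p := fun p => by simp [hf]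
  have hfsurj : Function.Surjective f := fun p => ⟨_, hfs p⟩
  have hs1 : ∀ i, s i = 1 ∨ s i = -1 := by
    intro i
    rcases Fin.eq_self_or_eq_succAbove j i with rfl | ⟨p, rfl⟩
    · simpa [hs] using hσ
    · simp [hs]
  have hrange : ∀ v : Fin (n + 1) → ℝ, v j = σ * v (j.succAbove i') →
      pullVec f s (fun p => v (j.succAbove p)) = v := by
    intro v hv
    ext i
    show (s i : ℝ) * v (j.succAbove (f i)) = v i
    rcases Fin.eq_self_or_eq_succAbove j i with rfl | ⟨p, rfl⟩
    · simp [hs, hf, hv]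
    · simp [hs, hf]
  set Γ' : AddSubgroup (Torus n) := Γ.comap (pullTorus f s) with hΓ'
  have hcl : IsClosed (Γ' : Set (Torus n)) := hΓ.preimage (continuous_pullTorus f s)
  have hiff : ∀ b : Fin n → ℝ, center n + proj n b ∈ Γ' ↔
      center (n + 1) + proj (n + 1) (pullVec f s b) ∈ Γ := by
    intro b
    rw [hΓ', AddSubgroup.mem_comap, map_add, pullTorus_center f hs1, proj_pullVec]
  have heq : D (Γ' : Set (Torus n)) = D (Γ : Set (Torus (n + 1))) := by
    apply le_antisymm
    · rw [← had, ← hrange a hja, norm_pullVec hfsurj hs1]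
      apply D_le_norm
      rw [hiff, hrange a hja]
      exact ha
    · obtain ⟨b, hb, hbd⟩ := exists_norm_eq_D hcl
      rw [← hbd, ← norm_pullVec hfsurj hs1]
      exact D_le_norm ((hiff b).1 hb)
  -- The plane meets the hyperplane v_j = σ v_i in a nonzero vector, so the pulled-back group still
  -- has positive dimension.
  obtain ⟨v, hv, hv0, hvφ⟩ := exists_ne_zero_map_eq_zero hu hw hu0 hwu
    ((LinearMap.proj j : (Fin (n + 1) → ℝ) →ₗ[ℝ] ℝ) -
      (σ : ℝ) • (LinearMap.proj (j.succAbove i') : (Fin (n + 1) → ℝ) →ₗ[ℝ] ℝ))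
  have hvj := hrange v (sub_eq_zero.1 hvφ)
  rw [← heq]
  refine D_mem_SStar hcl (by rwa [heq]) (e := fun p => v (j.succAbove p)) ?_ ?_
  · intro t
    rw [hΓ', AddSubgroup.mem_comap, ← proj_pullVec, map_smul, hvj]
    exact hv t
  · intro h0
    apply hv0
    rw [← hvj, h0, map_zero]

/-! ### Well-ordering, closedness and limit points -/

theorem D_limitSubgroup_eq {Δ : ℕ → AddSubgroup (Torus n)} {x : ℝ}
    (h : Tendsto (fun j => D (Δ j : Set (Torus n))) atTop (𝓝 x)) :
    D (limitSubgroup (hyperfilter ℕ : Filter ℕ) Δ : Set (Torus n)) = x :=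
  tendsto_nhds_unique (tendsto_D_limitSubgroup (hyperfilter ℕ) Δ)
    (h.mono_left Nat.hyperfilter_le_atTop)

/-- Some `Δ j` lies in the limit group, so its value is at least the limit of the values, which a
strictly increasing sequence forbids. -/
theorem not_strictMono_D (Δ : ℕ → AddSubgroup (Torus n)) :
    ¬ StrictMono (fun j => D (Δ j : Set (Torus n))) := by
  intro hmono
  obtain ⟨j, hj⟩ := (eventually_le_limitSubgroup (hyperfilter ℕ) Δ).exists
  have h1 := tendsto_D_limitSubgroup (hyperfilter ℕ) Δ
  have h2 : ∀ᶠ k in (hyperfilter ℕ : Filter ℕ),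
      D (Δ (j + 1) : Set (Torus n)) ≤ D (Δ k : Set (Torus n)) :=
    Nat.hyperfilter_le_atTop ((eventually_ge_atTop (j + 1)).mono fun k hk => hmono.monotone hk)
  have h3 := ge_of_tendsto h1 h2
  have h4 : D (Δ j : Set (Torus n)) < D (Δ (j + 1) : Set (Torus n)) := hmono (Nat.lt_succ_self j)
  linarith [D_anti hj]

theorem isWellOrder_before {A : Set ℝ} (h : ∀ d : ℕ → ℝ, (∀ j, d j ∈ A) → ¬ StrictMono d) :
    IsWellOrder A (Before A) := by
  have hwf : WellFounded (Before A) := by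
    rw [wellFounded_iff_isEmpty_descending_chain]
    refine ⟨fun ⟨f, hf⟩ => h (fun j => f j) (fun j => (f j).2) (strictMono_nat_of_lt_succ hf)⟩
  have : IsWellFounded A (Before A) := ⟨hwf⟩
  have : IsTrans A (Before A) := ⟨fun a b c hab hbc => lt_trans (b := (b : ℝ)) hbc hab⟩
  have : Std.Trichotomous (Before A) := ⟨fun a b h1 h2 =>
    Subtype.ext (le_antisymm (not_lt.1 h1) (not_lt.1 h2))⟩
  exact {}

theorem isWellOrder_SStar (n : ℕ) : IsWellOrder (SStar n) (Before (SStar n)) := by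
  refine isWellOrder_before fun d hd hmono => ?_
  choose Δ _ _ hΔ _ using fun j => exists_of_mem_SStar (hd j)
  refine not_strictMono_D Δ ?_
  simpa only [hΔ] using hmono

theorem isWellOrder_S (n : ℕ) : IsWellOrder (S n) (Before (S n)) := by
  refine isWellOrder_before fun d hd hmono => ?_
  choose Δ _ _ hΔ _ using fun j => exists_of_mem_SStar (S_subset_SStar (hd j))
  refine not_strictMono_D Δ ?_
  simpa only [hΔ] using hmono

theorem isClosed_SStar (n : ℕ) : IsClosed (SStar n) := by
  refine IsSeqClosed.isClosed fun d x hd hx => ?_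
  choose Δ hcl hlt hΔ e he he0 using fun j => exists_of_mem_SStar (hd j)
  have hD : D (limitSubgroup (hyperfilter ℕ : Filter ℕ) Δ : Set (Torus n)) = x :=
    D_limitSubgroup_eq (by simpa only [hΔ] using hx)
  obtain ⟨j, hj⟩ := (eventually_le_limitSubgroup (hyperfilter ℕ) Δ).exists
  rw [← hD]
  exact D_mem_SStar (isClosed_limitSubgroup _ _) ((D_anti hj).trans_lt (hlt j))
    (lineal_mono hj (he j)) (he0 j)

/-- The limit group contains the direction of some `Δ j` and also the small vector `w` from the
optimal point to a nearby point of `Δ j`. Were these parallel, the optimal point would lie in `Δ j`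
and the value would already equal the limit. So the limit group has dimension at least two. -/
theorem mem_SStar_of_tendsto {d : ℕ → ℝ} {x : ℝ} (hd : ∀ j, d j ∈ SStar (n + 1))
    (hx : Tendsto d atTop (𝓝 x)) (hne : ∀ j, d j ≠ x) : x ∈ SStar n := by
  choose Δ hcl hlt hΔ e he he0 using fun j => exists_of_mem_SStar (hd j)
  set Γ := limitSubgroup (hyperfilter ℕ : Filter ℕ) Δ with hΓ
  have hΓcl : IsClosed (Γ : Set (Torus (n + 1))) := isClosed_limitSubgroup _ _
  have hD : D (Γ : Set (Torus (n + 1))) = x :=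
    D_limitSubgroup_eq (by simpa only [hΔ] using hx)
  obtain ⟨δ, hδ, hL⟩ := exists_lineal_nhds hΓcl
  obtain ⟨a, ha, had⟩ := exists_norm_eq_D hΓcl
  obtain ⟨j, hj, y, hy, hyd⟩ :=
    ((eventually_le_limitSubgroup (hyperfilter ℕ) Δ).and (ha δ hδ)).exists
  obtain ⟨w, hw, hwn⟩ := exists_lift_norm (y - (center (n + 1) + proj (n + 1) a))
  have hwV : w ∈ lineal Γ := by
    apply hL
    · rwa [hwn, ← dist_eq_norm, dist_comm]
    · rw [hw]; exact sub_mem (hj hy) ha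
  rw [← hD]
  refine D_mem_SStar_of_plane hΓcl ((D_anti hj).trans_lt (hlt j)) (lineal_mono hj (he j)) hwV
    (he0 j) fun hspan => hne j ?_
  have hwΔ : w ∈ lineal (Δ j) := Submodule.span_le.2 (Set.singleton_subset_iff.2 (he j)) hspan
  have hmem : center (n + 1) + proj (n + 1) a ∈ Δ j := by
    have := sub_mem hy (proj_mem_of_mem_lineal hwΔ)
    rwa [hw, sub_sub_cancel] at this
  rw [← hΔ j, ← hD]
  exact le_antisymm ((D_le_norm hmem).trans had.le) (D_anti hj)

/-- A torsion optimal point of the limit group is near a point of some line inside that group, hence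
lifts to a vector `v` of the linear part. An integer multiple of `v` is an integer vector, and its
line stays in the limit group and passes through the optimal point. -/
theorem isClosed_S (n : ℕ) : IsClosed (S n) := by
  refine IsSeqClosed.isClosed fun d x hd hx => ?_
  choose u hu hlt hΔ using fun j => mem_S_iff.1 (hd j)
  set Γ := limitSubgroup (hyperfilter ℕ : Filter ℕ) (fun j => lineTorus (u j)) with hΓ
  have hΓcl : IsClosed (Γ : Set (Torus n)) := isClosed_limitSubgroup _ _
  have hD : D (Γ : Set (Torus n)) = x :=
    D_limitSubgroup_eq (by simpa only [hΔ] using hx)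
  obtain ⟨δ, hδ, hL⟩ := exists_lineal_nhds hΓcl
  obtain ⟨a, ha, had, hext⟩ := exists_extreme hΓcl
  obtain ⟨k, hk, hkp⟩ := exists_torsion_of_extreme hΓcl ha had hext
  obtain ⟨j, hj, y, hy, hyd⟩ :=
    ((eventually_le_limitSubgroup (hyperfilter ℕ) (fun j => lineTorus (u j))).and
      (ha δ hδ)).exists
  have hlt' : D (Γ : Set (Torus n)) < 1 / 2 := (D_anti hj).trans_lt (hlt j)
  obtain ⟨w, hw, hwn⟩ := exists_lift_norm (y - (center n + proj n a))
  have hwV : w ∈ lineal Γ := by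
    apply hL
    · rwa [hwn, ← dist_eq_norm, dist_comm]
    · rw [hw]; exact sub_mem (hj hy) ha
  obtain ⟨t, ht⟩ := mem_lineTorus.1 hy
  have hvV := sub_mem (Submodule.smul_mem _ t (lineTorus_le_iff.1 hj)) hwV
  set v := (t • fun i => (u j i : ℝ)) - w with hv
  have hvp : proj n v = center n + proj n a := by rw [hv, map_sub, ht, hw, sub_sub_cancel]
  obtain ⟨m, hm⟩ := (proj_eq_zero_iff (k • v)).1 (by rw [map_nsmul, hvp, hkp])
  have hmV : (fun i => (m i : ℝ)) ∈ lineal Γ := by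
    rw [← hm]; exact Submodule.smul_of_tower_mem _ k hvV
  have hk0 : (k : ℝ) ≠ 0 := by positivity
  have hvm : (1 / (k : ℝ)) • (fun i => (m i : ℝ)) = v := by
    rw [← hm, ← Nat.cast_smul_eq_nsmul ℝ, smul_smul, one_div, inv_mul_cancel₀ hk0, one_smul]
  have hpm : center n + proj n a ∈ lineTorus m :=
    mem_lineTorus.2 ⟨1 / k, by rw [hvm, hvp]⟩
  have hDm : D (lineTorus m : Set (Torus n)) = D (Γ : Set (Torus n)) :=
    le_antisymm ((D_le_norm hpm).trans had.le) (D_anti (lineTorus_le_iff.2 hmV))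
  refine mem_S_iff.2 ⟨m, fun h0 => ?_, hDm ▸ hlt', hDm.trans hD⟩
  have hv0 : v = 0 := by rw [← hvm, h0, smul_zero]
  -- Only the existence of a coordinate matters: if `m` were 0 the optimal point would be 0, but a
  -- value below 1/2 excludes zero coordinates.
  obtain ⟨i, -⟩ := Function.ne_iff.1 (hu j)
  refine coord_ne_zero_of_norm_lt (had ▸ hlt') i ?_
  rw [← hvp, hv0, map_zero, Pi.zero_apply]

/-! ### Approximation from above in one more dimension -/

/-- At an optimal time some extremal coordinate blocks the forward motion and some extremal
coordinate blocks the backward motion. They agree up to sign modulo ℤ, which makes t(u_j − σu_i) an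
integer. A vanishing coefficient would force u_i = 0, excluded by the value being below 1/2. -/
theorem coe_mul_eq_zero_of_optimal {u : Fin n → ℤ} (hu : (fun i => (u i : ℝ)) ≠ 0)
    (hD : D (lineTorus u : Set (Torus n)) < 1 / 2) {a : Fin n → ℝ} {t : ℝ}
    (hat : center n + proj n a = proj n (t • fun i => (u i : ℝ)))
    (had : ‖a‖ = D (lineTorus u : Set (Torus n))) :
    ∃ i j, ∃ σ : ℤ, (σ = 1 ∨ σ = -1) ∧ u j - σ * u i ≠ 0 ∧
      ((t * ((u j - σ * u i : ℤ) : ℝ) : ℝ) : UnitAddCircle) = 0 := by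
  have ha : center n + proj n a ∈ lineTorus u := mem_lineTorus.2 ⟨t, hat.symm⟩
  have key : ∀ i j, ∀ σ : ℤ, (σ = 1 ∨ σ = -1) → a j = σ * a i →
      ((t * ((u j - σ * u i : ℤ) : ℝ) : ℝ) : UnitAddCircle) = 0 := by
    intro i j σ hσ hij
    have hc : ∀ i, ((t * u i : ℝ) : UnitAddCircle) = center n i + ((a i : ℝ) : UnitAddCircle) :=
      fun i => (congrFun hat i).symm
    have h1 : t * ((u j - σ * u i : ℤ) : ℝ) = t * u j - σ * (t * u i) := by push_cast; ring
    rw [h1, AddCircle.coe_sub, ← zsmul_eq_mul, AddCircle.coe_zsmul, hc, hc, smul_add,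
      sign_smul_center_apply hσ, ← AddCircle.coe_zsmul, zsmul_eq_mul, ← hij]
    exact sub_self _
  rcases (norm_nonneg a).eq_or_lt with h0 | hpos
  · have ha0 : a = 0 := norm_eq_zero.1 h0.symm
    obtain ⟨i, hi⟩ := Function.ne_iff.1 hu
    have hi' : u i ≠ 0 := by simpa using hi
    -- At the centre itself one nonzero speed suffices: 2tuᵢ is an integer.
    exact ⟨i, i, -1, Or.inr rfl, by omega, key i i (-1) (Or.inr rfl) (by simp [ha0])⟩
  · have huV : (fun i => (u i : ℝ)) ∈ lineal (lineTorus u) := lineTorus_le_iff.1 le_rfl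
    obtain ⟨i, hi, hi0⟩ := exists_tight_nonneg ha had hpos huV
    obtain ⟨j, hj, hj0⟩ := exists_tight_nonneg ha had hpos (Submodule.neg_mem _ huV)
    have hsign : ∃ σ : ℤ, (σ = 1 ∨ σ = -1) ∧ a j = σ * a i := by
      rcases abs_eq_abs.1 (hj.trans hi.symm) with h | h
      · exact ⟨1, Or.inl rfl, by simp [h]⟩
      · exact ⟨-1, Or.inr rfl, by simp [h]⟩
    obtain ⟨σ, hσ, hja⟩ := hsign
    refine ⟨i, j, σ, hσ, fun hu0 => ?_, key i j σ hσ hja⟩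
    have huj : (u j : ℝ) = σ * u i := by
      have : u j = σ * u i := by linarith
      exact_mod_cast this
    have hss : (σ : ℝ) * σ = 1 := by rcases hσ with rfl | rfl <;> norm_num
    have h1 : a j * u j = a i * u i := by
      rw [hja, huj]; linear_combination (a i * u i) * hss
    simp only [Pi.neg_apply, mul_neg, h1] at hj0
    have h2 : a i * u i = 0 := le_antisymm (by linarith) hi0
    have hai : a i ≠ 0 := by
      intro h; rw [h, abs_zero] at hi; exact hpos.ne hi
    have hui : (u i : ℝ) = 0 := (mul_eq_zero.1 h2).resolve_left hai
    refine coord_ne_zero_of_norm_lt (had ▸ hD) i ?_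
    rw [hat, proj_apply, Pi.smul_apply, hui, smul_zero]
    rfl

/-- The optimal parameters on a line have a common denominator. -/
theorem exists_common_denominator {u : Fin n → ℤ} (hu : (fun i => (u i : ℝ)) ≠ 0)
    (hD : D (lineTorus u : Set (Torus n)) < 1 / 2) :
    ∃ M : ℕ, 0 < M ∧ ∀ (a : Fin n → ℝ) (t : ℝ),
      center n + proj n a = proj n (t • fun i => (u i : ℝ)) →
      ‖a‖ = D (lineTorus u : Set (Torus n)) →
      ((t * M : ℝ) : UnitAddCircle) = 0 := by
  classical
  -- Vanishing combinations are replaced by 1 so that the product below is a positive common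
  -- multiple of the others.
  set g : ℤ → ℕ := fun q => if q = 0 then 1 else q.natAbs with hg
  have hgpos : ∀ q, 0 < g q := fun q => by
    simp only [hg]; split_ifs with h
    · norm_num
    · exact Int.natAbs_pos.2 h
  have hgq : ∀ q, q ≠ 0 → q ∣ (g q : ℤ) := fun q hq => by
    simp only [hg, if_neg hq]; exact Int.dvd_natAbs_self
  refine ⟨∏ p : Fin n × Fin n × Bool, g (u p.2.1 - (if p.2.2 then 1 else -1) * u p.1),
    Finset.prod_pos fun p _ => hgpos _, fun a t hat had => ?_⟩
  obtain ⟨i, j, σ, hσ, hq, h0⟩ := coe_mul_eq_zero_of_optimal hu hD hat had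
  have hdvd : (u j - σ * u i) ∣ ((∏ p : Fin n × Fin n × Bool,
      g (u p.2.1 - (if p.2.2 then 1 else -1) * u p.1) : ℕ) : ℤ) := by
    refine (hgq _ hq).trans (Int.natCast_dvd_natCast.2 ?_)
    have : u j - σ * u i = (fun p : Fin n × Fin n × Bool =>
        u p.2.1 - (if p.2.2 then 1 else -1) * u p.1) (i, j, decide (σ = 1)) := by
      rcases hσ with rfl | rfl <;> simp
    rw [this]
    exact Finset.dvd_prod_of_mem
      (fun p : Fin n × Fin n × Bool => g (u p.2.1 - (if p.2.2 then 1 else -1) * u p.1))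
      (Finset.mem_univ _)
  obtain ⟨c, hc⟩ := hdvd
  have h1 : (t * ((∏ p : Fin n × Fin n × Bool,
      g (u p.2.1 - (if p.2.2 then 1 else -1) * u p.1) : ℕ) : ℝ)) =
      c * (t * ((u j - σ * u i : ℤ) : ℝ)) := by
    rw [← Int.cast_natCast (R := ℝ), hc]; push_cast; ring
  rw [h1, ← zsmul_eq_mul, AddCircle.coe_zsmul, h0, smul_zero]

/-- Every element of `S n` is a limit of larger elements of `S (n + 1)`. -/
theorem exists_mem_S_succ_between {d : ℝ} (hd : d ∈ S n) {ε : ℝ} (hε : 0 < ε) :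
    ∃ d' ∈ S (n + 1), d < d' ∧ d' < d + ε := by
  obtain ⟨u, hu, hD, rfl⟩ := mem_S_iff.1 hd
  obtain ⟨M, hM, hMt⟩ := exists_common_denominator hu hD
  set v : Fin n → ℝ := fun i => (u i : ℝ) with hv
  -- Capping by the gap to 1/2 keeps the new line proper.
  set η := min ε (1 / 2 - D (lineTorus u : Set (Torus n))) with hη
  have hηpos : 0 < η := lt_min hε (by linarith)
  obtain ⟨N, hN⟩ := exists_nat_gt (‖v‖ / η)
  have hNpos : (0 : ℝ) < N := lt_of_le_of_lt (by positivity) hN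
  rw [div_lt_iff₀ hηpos] at hN
  -- Divisibility by `M` puts the new coordinate at 0 at every old optimal time, so the value must
  -- grow; the size of `N` keeps the growth below η.
  set m : ℕ := M * N with hm
  have hmN : (N : ℝ) ≤ m := by
    have : (1 : ℝ) ≤ M := by exact_mod_cast hM
    rw [hm]; push_cast; nlinarith
  have hmpos : (0 : ℝ) < m := hNpos.trans_le hmN
  set u' : Fin (n + 1) → ℤ := Fin.snoc (α := fun _ => ℤ) u (m : ℤ) with hu'
  have hu'0 : (fun i => (u' i : ℝ)) ≠ 0 := by
    intro h
    have := congrFun h (Fin.last n)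
    simp [hu'] at this
    have h2 : (m : ℝ) ≠ 0 := hmpos.ne'
    exact h2 (by exact_mod_cast this)
  have hcast : ∀ (b : Fin (n + 1) → ℝ) (t : ℝ),
      center (n + 1) + proj (n + 1) b = proj (n + 1) (t • fun i => (u' i : ℝ)) ↔
      (center n + proj n (fun i => b i.castSucc) = proj n (t • v) ∧
        ((1 / 2 + b (Fin.last n) : ℝ) : UnitAddCircle) = ((t * m : ℝ) : UnitAddCircle)) := by
    intro b t
    constructor
    · intro h
      constructor
      · ext i
        have h1 := congrFun h i.castSucc
        rw [proj_apply] at h1 ⊢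
        simp only [hu', Pi.smul_apply, Fin.snoc_castSucc] at h1
        exact h1
      · have h1 := congrFun h (Fin.last n)
        rw [proj_apply] at h1
        simp only [hu', Pi.smul_apply, Fin.snoc_last, smul_eq_mul, Int.cast_natCast] at h1
        exact h1
    · rintro ⟨h1, h2⟩
      ext i
      refine Fin.lastCases ?_ (fun i => ?_) i
      · rw [proj_apply]
        simp only [hu', Pi.smul_apply, Fin.snoc_last, smul_eq_mul, Int.cast_natCast]
        exact h2
      · rw [proj_apply]
        simp only [hu', Pi.smul_apply, Fin.snoc_castSucc]
        exact congrFun h1 i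
  have hupper : D (lineTorus u' : Set (Torus (n + 1))) <
      D (lineTorus u : Set (Torus n)) + η := by
    obtain ⟨a, ha, had⟩ := exists_norm_eq_D (isClosed_lineTorus u)
    obtain ⟨t, ht⟩ := mem_lineTorus.1 ha
    -- At this nearby time the new coordinate is exactly 1/2, and the old ones have moved by at most
    -- ‖v‖/m.
    set t' : ℝ := (⌊t * m⌋ + 1 / 2) / m with ht'
    have htt : |t' - t| ≤ 1 / m := by
      have h1 := Int.floor_le (t * m)
      have h2 := (Int.lt_floor_add_one (t * m)).le
      have h3 : t' - t = (⌊t * m⌋ + 1 / 2 - t * m) / m := by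
        rw [ht']; field_simp
      rw [h3, abs_div, abs_of_pos hmpos]
      gcongr
      rw [abs_le]; constructor <;> linarith
    set b : Fin (n + 1) → ℝ := Fin.snoc (α := fun _ => ℝ) (a + (t' - t) • v) 0 with hb
    have hbm : center (n + 1) + proj (n + 1) b ∈ lineTorus u' := by
      refine mem_lineTorus.2 ⟨t', ((hcast b t').2 ⟨?_, ?_⟩).symm⟩
      · have : (fun i => b i.castSucc) = a + (t' - t) • v := by
          ext i; simp [hb]
        rw [this, map_add, ← add_assoc, ← ht, ← map_add]
        congr 1
        rw [← add_smul, add_sub_cancel]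
      · have h1 : t' * m = ⌊t * m⌋ + 1 / 2 := by rw [ht']; field_simp
        have h2 : ((⌊t * m⌋ : ℝ) : UnitAddCircle) = 0 :=
          (AddCircle.coe_eq_zero_iff 1).2 ⟨⌊t * m⌋, by simp⟩
        rw [h1, AddCircle.coe_add (1 : ℝ) (⌊t * m⌋ : ℝ) (1 / 2), h2, zero_add]
        simp [hb]
    have hbn : ‖b‖ ≤ ‖a‖ + 1 / m * ‖v‖ := by
      refine (pi_norm_le_iff_of_nonneg (by positivity)).2 fun i => ?_
      refine Fin.lastCases ?_ (fun i => ?_) i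
      · simp only [hb, Fin.snoc_last, norm_zero]; positivity
      · simp only [hb, Fin.snoc_castSucc]
        refine (norm_le_pi_norm _ i).trans ((norm_add_le _ _).trans ?_)
        rw [norm_smul]
        gcongr
        exact htt
    have hs : 1 / m * ‖v‖ < η := by
      rw [one_div, inv_mul_lt_iff₀ hmpos]
      nlinarith
    linarith [D_le_norm hbm]
  have hη1 : η ≤ ε := min_le_left _ _
  have hη2 : η ≤ 1 / 2 - D (lineTorus u : Set (Torus n)) := min_le_right _ _
  have hD' : D (lineTorus u' : Set (Torus (n + 1))) < 1 / 2 := by linarith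
  refine ⟨_, mem_S_iff.2 ⟨u', hu'0, hD', rfl⟩, ?_, by linarith⟩
  obtain ⟨b, hb, hbd⟩ := exists_norm_eq_D (isClosed_lineTorus u')
  obtain ⟨t, ht⟩ := mem_lineTorus.1 hb
  obtain ⟨h1, h2⟩ := (hcast b t).1 ht.symm
  have h3 : D (lineTorus u : Set (Torus n)) ≤ ‖fun i : Fin n => b i.castSucc‖ :=
    D_le_norm (mem_lineTorus.2 ⟨t, h1.symm⟩)
  have h4 : ‖fun i : Fin n => b i.castSucc‖ ≤ ‖b‖ :=
    (pi_norm_le_iff_of_nonneg (norm_nonneg _)).2 fun i => norm_le_pi_norm b _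
  rw [← hbd]
  -- Equality would make `t` an optimal time of the old line, where the new coordinate is 0; this
  -- contradicts `hD'`.
  refine lt_of_le_of_ne (h3.trans h4) fun heq => ?_
  have h5 := hMt _ t h1 (le_antisymm (h4.trans heq.symm.le) h3)
  refine coord_ne_zero_of_norm_lt (a := b) (by rw [hbd]; exact hD') (Fin.last n) ?_
  have h6 : (center (n + 1) + proj (n + 1) b) (Fin.last n) =
      ((1 / 2 + b (Fin.last n) : ℝ) : UnitAddCircle) := rfl
  have h7 : t * m = (N : ℤ) * (t * M) := by rw [hm]; push_cast; ring
  rw [h6, h2, h7, ← zsmul_eq_mul, AddCircle.coe_zsmul, h5, smul_zero]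

theorem S_subset_S_succ (n : ℕ) : S n ⊆ S (n + 1) := by
  intro d hd
  rw [← (isClosed_S (n + 1)).closure_eq, Metric.mem_closure_iff]
  intro ε hε
  obtain ⟨d', hd', h1, h2⟩ := exists_mem_S_succ_between hd hε
  exact ⟨d', hd', by rw [Real.dist_eq, abs_lt]; constructor <;> linarith⟩

/-! ### Counting ordinal ranks -/

open Ordinal in
/-- Lower bound for ranks in a decreasingly well-ordered set, given a chain of subsets each of whose
points is a limit from above of the previous one. -/
theorem typein_add_opow_le {A : Set ℝ} [IsWellOrder A (Before A)] {F : ℕ → Set ℝ}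
    (hF : ∀ k, F k ⊆ A)
    (hacc : ∀ k, ∀ d ∈ F (k + 1), ∀ ε > 0, ∃ d' ∈ F k, d < d' ∧ d' < d + ε) (k : ℕ) :
    ∀ (d : ℝ) (hd : d ∈ F k) (x : A), d < x →
      typein (Before A) x + ω ^ (k : Ordinal.{0}) ≤ typein (Before A) ⟨d, hF k hd⟩ := by
  induction k with
  | zero =>
    intro d hd x hx
    rw [Nat.cast_zero, opow_zero, ← Order.succ_eq_add_one, Order.succ_le_iff]
    exact (typein_lt_typein (Before A)).2 hx
  | succ k ih =>
    intro d hd x hx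
    -- Points of `F k` descending to `d` stack m blocks of length ω^k after `x`, all before `d`.
    have key : ∀ m : ℕ, ∃ y : A, d < y ∧
        typein (Before A) x + ω ^ (k : Ordinal.{0}) * m ≤ typein (Before A) y := by
      intro m
      induction m with
      | zero => exact ⟨x, hx, by simp⟩
      | succ m ihm =>
        obtain ⟨y, hy, hle⟩ := ihm
        obtain ⟨d', hd', h1, h2⟩ := hacc k d hd (y - d) (sub_pos.2 hy)
        refine ⟨⟨d', hF k hd'⟩, h1, ?_⟩
        refine le_trans ?_ (ih d' hd' y (by linarith))
        rw [Nat.cast_succ, mul_add, mul_one, ← add_assoc]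
        gcongr
    rw [Nat.cast_succ, opow_add, opow_one]
    by_contra! hlt
    have hxd : typein (Before A) x ≤ typein (Before A) ⟨d, hF (k + 1) hd⟩ :=
      ((typein_lt_typein (Before A) (a := x) (b := ⟨d, hF (k + 1) hd⟩)).2 hx).le
    obtain ⟨c, hc, hlt'⟩ :=
      (lt_mul_iff_of_isSuccLimit isSuccLimit_omega0).1 ((sub_lt_of_le hxd).2 hlt)
    obtain ⟨m, rfl⟩ := lt_omega0.1 hc
    obtain ⟨y, hy, hle⟩ := key m
    exact lt_asymm (((sub_lt_of_le hxd).1 hlt').trans_le hle)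
      ((typein_lt_typein (Before A)).2 hy)

open Ordinal in
/-- A strictly decreasing family indexed by an interval of length `ω ^ k` has its infimum in the
`k`-th member of a chain of sets, each of which contains the limit points of the previous one. -/
theorem exists_isGLB_image_Ico {F : ℕ → Set ℝ} (hbdd : ∀ d ∈ F 0, 0 ≤ d)
    (hacc : ∀ k (d : ℕ → ℝ) (x : ℝ), (∀ j, d j ∈ F k) → Tendsto d atTop (𝓝 x) →
      (∀ j, d j ≠ x) → x ∈ F (k + 1)) (f : Ordinal.{0} → ℝ) (k : ℕ) :
    ∀ α : Ordinal.{0}, (∀ o ∈ Set.Ico α (α + ω ^ (k : Ordinal.{0})), f o ∈ F 0) →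
      StrictAntiOn f (Set.Ico α (α + ω ^ (k : Ordinal.{0}))) →
      ∃ b ∈ F k, IsGLB (f '' Set.Ico α (α + ω ^ (k : Ordinal.{0}))) b := by
  induction k with
  | zero =>
    intro α hf _
    have hI : Set.Ico α (α + ω ^ ((0 : ℕ) : Ordinal.{0})) = {α} := by
      ext o
      rw [Nat.cast_zero, opow_zero, Set.mem_Ico, Order.lt_add_one_iff, Set.mem_singleton_iff]
      exact ⟨fun h => le_antisymm h.2 h.1, fun h => h ▸ ⟨le_rfl, le_rfl⟩⟩
    rw [hI] at hf ⊢
    exact ⟨f α, hf α rfl, by simp⟩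
  | succ k ih =>
    intro α hf hanti
    have hpow : ω ^ ((k + 1 : ℕ) : Ordinal.{0}) = ω ^ (k : Ordinal.{0}) * ω := by
      rw [Nat.cast_succ, opow_add, opow_one]
    have hkpos : 0 < ω ^ (k : Ordinal.{0}) := opow_pos _ omega0_pos
    -- The interval is cut into ω blocks of length ω^k. The block infima lie in `F k` and decrease
    -- to the overall infimum.
    set β : ℕ → Ordinal.{0} := fun m => α + ω ^ (k : Ordinal.{0}) * m with hβ
    have hβs : ∀ m, β m + ω ^ (k : Ordinal.{0}) = β (m + 1) := fun m => by
      simp only [hβ]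
      rw [Nat.cast_succ, mul_add, mul_one, ← add_assoc]
    have hβlt : ∀ m, β m < α + ω ^ ((k + 1 : ℕ) : Ordinal.{0}) := fun m => by
      rw [hpow]
      exact (add_lt_add_iff_left α).2 (mul_lt_mul_of_pos_left (natCast_lt_omega0 m) hkpos)
    have hβα : ∀ m, α ≤ β m := fun m => le_add_of_nonneg_right zero_le
    have hβmono : StrictMono β := strictMono_nat_of_lt_succ fun m => by
      rw [← hβs]; exact lt_add_of_pos_right _ hkpos
    have hsub : ∀ m, Set.Ico (β m) (β m + ω ^ (k : Ordinal.{0})) ⊆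
        Set.Ico α (α + ω ^ ((k + 1 : ℕ) : Ordinal.{0})) := fun m o ho =>
      ⟨(hβα m).trans ho.1, (ho.2.trans_eq (hβs m)).trans (hβlt _)⟩
    have hβmem : ∀ m, β m ∈ Set.Ico α (α + ω ^ ((k + 1 : ℕ) : Ordinal.{0})) := fun m =>
      ⟨hβα m, hβlt m⟩
    choose b hbF hb using fun m => ih (β m) (fun o ho => hf o (hsub m ho)) (hanti.mono (hsub m))
    have hble : ∀ m, b m ≤ f (β m) := fun m =>
      (hb m).1 ⟨β m, ⟨le_rfl, lt_add_of_pos_right _ hkpos⟩, rfl⟩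
    have hbge : ∀ m, f (β (m + 1)) ≤ b m := fun m => by
      refine (hb m).2 ?_
      rintro _ ⟨o, ho, rfl⟩
      exact (hanti (hsub m ho) (hβmem _) (ho.2.trans_eq (hβs m))).le
    have hbanti : Antitone b := antitone_nat_of_succ_le fun m => (hble _).trans (hbge m)
    have hb0 : ∀ m, 0 ≤ b m := fun m => (hbdd _ (hf _ (hβmem _))).trans (hbge m)
    have hbb : BddBelow (Set.range b) := ⟨0, by rintro _ ⟨m, rfl⟩; exact hb0 m⟩
    have hlim := tendsto_atTop_ciInf hbanti hbb
    refine ⟨⨅ m, b m, hacc k b _ hbF hlim fun m heq => ?_, ?_, ?_⟩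
    · have h1 := hanti (hβmem (m + 1)) (hβmem (m + 2)) (hβmono (Nat.lt_succ_self _))
      have h2 := ciInf_le hbb (m + 2)
      linarith [hble (m + 2), hbge m]
    · rintro _ ⟨o, ho, rfl⟩
      obtain ⟨m, hm⟩ : ∃ m, o < β m := by
        have h1 : o - α < ω ^ (k : Ordinal.{0}) * ω := by
          rw [← hpow]
          exact (sub_lt_of_le ho.1).2 ho.2
        obtain ⟨c, hc, hlt⟩ := (lt_mul_iff_of_isSuccLimit isSuccLimit_omega0).1 h1
        obtain ⟨m, rfl⟩ := lt_omega0.1 hc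
        exact ⟨m, (sub_lt_of_le ho.1).1 hlt⟩
      linarith [hanti ho (hβmem m) hm, hble m, ciInf_le hbb m]
    · intro y hy
      exact le_ciInf fun m => (hb m).2 fun z hz => hy (Set.image_mono (hsub m) hz)

theorem notMem_SStar_zero {d : ℝ} : d ∉ SStar 0 := by
  intro hd
  obtain ⟨Γ, -, -, -, e, -, he0⟩ := exists_of_mem_SStar hd
  exact he0 (Subsingleton.elim _ _)

-- The point 0 comes from `S 1`, n − 1 accumulation steps down from `S n`, so its rank is at least
-- ω^(n−1); the extra 1 counts 0 itself.
open Ordinal in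
theorem opow_add_one_le_type_S {n : ℕ} (hn : 2 ≤ n) :
    ω ^ ((n - 1 : ℕ) : Ordinal.{0}) + 1 ≤
      @type _ (Before (S n)) (isWellOrder_S n) := by
  have := isWellOrder_S n
  have hF : ∀ k, S (n - k) ⊆ S n := fun k =>
    monotone_nat_of_le_succ (f := S) S_subset_S_succ (Nat.sub_le n k)
  have hacc : ∀ k, ∀ d ∈ S (n - (k + 1)), ∀ ε > 0, ∃ d' ∈ S (n - k), d < d' ∧ d' < d + ε := by
    intro k d hd ε hε
    rcases Nat.lt_or_ge k n with hk | hk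
    · rw [show n - k = n - (k + 1) + 1 by omega]
      exact exists_mem_S_succ_between hd hε
    · rw [show n - (k + 1) = 0 by omega] at hd
      exact absurd (S_subset_SStar hd) notMem_SStar_zero
  have h0 : (0 : ℝ) ∈ S (n - (n - 1)) := by
    rw [show n - (n - 1) = 1 by omega]; exact zero_mem_S_one
  obtain ⟨x, hx, hx0, -⟩ : ∃ x ∈ S n, (0 : ℝ) < x ∧ x < 0 + 1 := by
    refine hacc 0 0 ?_ 1 one_pos
    exact monotone_nat_of_le_succ (f := S) S_subset_S_succ (by omega) zero_mem_S_one
  have h1 := typein_add_opow_le (A := S n) (F := fun k => S (n - k)) hF hacc (n - 1) 0 h0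
    ⟨x, hx⟩ hx0
  rw [← Order.succ_eq_add_one, Order.succ_le_iff]
  exact (le_add_self.trans h1).trans_lt (typein_lt_type _ _)

-- The first ω^(n−1) values have their infimum in `SStar 1`, hence equal to 0. The value at position
-- ω^(n−1) is then at most 0, and a further one would be negative.
open Ordinal in
theorem type_SStar_le {n : ℕ} (hn : 2 ≤ n) :
    @type _ (Before (SStar n)) (isWellOrder_SStar n) ≤
      ω ^ ((n - 1 : ℕ) : Ordinal.{0}) + 1 := by
  have := isWellOrder_SStar n
  by_contra! hlt
  have hacc : ∀ k (d : ℕ → ℝ) (x : ℝ), (∀ j, d j ∈ SStar (n - k)) → Tendsto d atTop (𝓝 x) →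
      (∀ j, d j ≠ x) → x ∈ SStar (n - (k + 1)) := by
    intro k d x hd hx hne
    rcases Nat.lt_or_ge k n with hk | hk
    · rw [show n - k = n - (k + 1) + 1 by omega] at hd
      exact mem_SStar_of_tendsto hd hx hne
    · have h := hd 0
      rw [show n - k = 0 by omega] at h
      exact absurd h notMem_SStar_zero
  set f : Ordinal.{0} → ℝ := fun o =>
    if h : o < type (Before (SStar n)) then (enum (Before (SStar n)) ⟨o, h⟩ : ℝ) else 0 with hf
  have hfmem : ∀ o < type (Before (SStar n)), f o ∈ SStar n := fun o ho => by
    simp only [hf, dif_pos ho]; exact Subtype.prop _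
  have hfanti : ∀ o₁ o₂, o₁ < o₂ → o₂ < type (Before (SStar n)) → f o₂ < f o₁ :=
    fun o₁ o₂ h h2 => by
      simp only [hf, dif_pos h2, dif_pos (h.trans h2)]
      exact (enum_lt_enum (r := Before (SStar n)) (o₁ := ⟨o₁, h.trans h2⟩) (o₂ := ⟨o₂, h2⟩)).2 h
  set γ := ω ^ ((n - 1 : ℕ) : Ordinal.{0}) with hγ
  have hγlt : γ < γ + 1 := lt_add_one γ
  obtain ⟨b, hb, hglb⟩ := exists_isGLB_image_Ico (F := fun k => SStar (n - k))
    (fun d hd => nonneg_of_mem_SStar hd) hacc f (n - 1) 0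
    (fun o ho => hfmem o (((zero_add γ ▸ ho.2).trans hγlt).trans hlt))
    (fun o₁ _ o₂ h₂ h => hfanti o₁ o₂ h (((zero_add γ ▸ h₂.2).trans hγlt).trans hlt))
  have hb0 : b = 0 := by
    have hb' : b ∈ SStar (n - (n - 1)) := hb
    rw [show n - (n - 1) = 1 by omega] at hb'
    exact SStar_one_subset hb'
  have h1 : f γ ≤ b := hglb.2 (by
    rintro _ ⟨o, ho, rfl⟩
    exact (hfanti o γ (zero_add γ ▸ ho.2) (hγlt.trans hlt)).le)
  have h2 := hfanti γ (γ + 1) hγlt hlt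
  have h3 := nonneg_of_mem_SStar (hfmem (γ + 1) hlt)
  linarith

open Ordinal in
theorem type_S_le_type_SStar (n : ℕ) :
    @type _ (Before (S n)) (isWellOrder_S n) ≤
      @type _ (Before (SStar n)) (isWellOrder_SStar n) := by
  have := isWellOrder_S n
  have := isWellOrder_SStar n
  exact type_le_iff'.2 ⟨⟨⟨Set.inclusion S_subset_SStar, Set.inclusion_injective _⟩, Iff.rfl⟩⟩

end LonelyRunner

theorem mainTheorem9 :
    (∀ n : ℕ, 1 ≤ n →
      IsClosed (LonelyRunner.S n) ∧ IsClosed (LonelyRunner.SStar n) ∧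
      IsWellOrder (LonelyRunner.S n) (LonelyRunner.Before (LonelyRunner.S n)) ∧
      IsWellOrder (LonelyRunner.SStar n) (LonelyRunner.Before (LonelyRunner.SStar n))) ∧
    (∀ n : ℕ, 2 ≤ n →
      LonelyRunner.HasDecreasingOrderType (LonelyRunner.S n)
        (Ordinal.omega0 ^ ((n - 1 : ℕ) : Ordinal.{0}) + 1) ∧
      LonelyRunner.HasDecreasingOrderType (LonelyRunner.SStar n)
        (Ordinal.omega0 ^ ((n - 1 : ℕ) : Ordinal.{0}) + 1)) := by
  refine ⟨fun n _ => ⟨LonelyRunner.isClosed_S n, LonelyRunner.isClosed_SStar n,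
    LonelyRunner.isWellOrder_S n, LonelyRunner.isWellOrder_SStar n⟩, fun n hn => ?_⟩
  have hlo := LonelyRunner.opow_add_one_le_type_S hn
  have hup := LonelyRunner.type_SStar_le hn
  have hle := LonelyRunner.type_S_le_type_SStar n
  exact ⟨⟨LonelyRunner.isWellOrder_S n, le_antisymm (hle.trans hup) hlo⟩,
    ⟨LonelyRunner.isWellOrder_SStar n, le_antisymm hup (hlo.trans hle)⟩⟩
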